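/- Fix an integer $m\ge 1$ and reals $\alpha>0$, $\delta>-1$. **Graph process.** Vertices $v_1,v_2,\dots$ arrive one at a time, each with $m$ half-edges. The process starts from $v_1$ alone, whose $m$ half-edges are left dangling, so that $v_1$ has degree $m$. For $n\ge 1$ the half-edges $e_{n+1,1},\dots,e_{n+1,m}$ of $v_{n+1}$ are attached one after another to vertices among $v_1,\dots,v_n$ (multiple edges may occur). For $1\le j\le n$ and $0\le k\le m-1$ let $d_j(n+1,k)$ be the degree of $v_j$ after the first $k$ half-edges of $v_{n+1}$ have been attached, and let $\mathcal F_{n+1,k}$ be the $\sigma$-algebra generated by all edges present at that moment. The attachment rule is, for $1\le i\le n$, $$P\big(e_{n+1,k+1}=\{v_{n+1},v_i\}\,\big|\,\mathcal F_{n+1,k}\big)=\frac{(\delta+d_i(n+1,k))^{-\alpha}}{\sum_{j=1}^n(\delta+d_j(n+1,k))^{-\alpha}}\quad\text{a.s.}$$ **Birth processes.** Let $Z_1,Z_2,\dots$ be i.i.d. (right-continuous) pure birth processes with $Z_j(0)=m$ a.s. and birth rates $\lambda_i=(i+\delta)^{-\alpha}$, $i\ge m$; that is, $Z_j$ increases by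 unit jumps and its holding times in the states $m,m+1,\dots$ are independent, the one in state $i$ being exponential with parameter $\lambda_i$. Start $Z_j$ at time $\tau_j$, where the random times are defined recursively by $\tau_1=0$ and, for $n\ge 1$, $$\tau_{n+1}=\tau_n+T^{(n+1)}_1+\dots+T^{(n+1)}_m ,$$ $T^{(n+1)}_k$ being the waiting time, after $\tau_n+T^{(n+1)}_1+\dots+T^{(n+1)}_{k-1}$, until the next birth in any of the processes $Z_1(\cdot-\tau_1),\dots,Z_n(\cdot-\tau_n)$. For $1\le j\le n$ and $0\le k\le m-1$ put $$\tilde d_j(n+1,k)=Z_j\big(\tau_n+T^{(n+1)}_1+\dots+T^{(n+1)}_k-\tau_j\big).$$ **Theorem.** The families $$\{\tilde d_j(n+1,k):\ 0\le k\le m-1,\ 1\le j\le n,\ n\ge 2\}\quad\text{and}\quad\{d_j(n+1,k):\ 0\le k\le m-1,\ 1\le j\le n,\ n\ge 2\}$$ have the same joint distribution. -/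

import Mathlib

open MeasureTheory ProbabilityTheory
open scoped NNReal

noncomputable section

namespace DePref

/-! ### The random graph process

Vertices are `1, 2, 3, …`; vertex `r` carries `m` half-edges `(r, 1), …, (r, m)`.  The graph starts
from vertex `1`, whose `m` half-edges are left dangling.  For `r ≥ 2` the half-edge `(r, l)` is
attached to an older vertex `w r l`. -/

/-- The set of end vertices of the edge made from the half-edge `(r, l)`. -/
def edge (w : ℕ → ℕ → ℕ) (r l : ℕ) : Finset ℕ :=
  if r = 1 then {1} else {r, w r l}

/-- The half-edges present once the vertices `1, …, n` are in the graph with all their half-edges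
and the first `k` half-edges of vertex `n + 1` have been attached. -/
def placed (m n k : ℕ) : Finset (ℕ × ℕ) :=
  (Finset.Icc 1 n ×ˢ Finset.Icc 1 m) ∪ ({n + 1} ×ˢ Finset.Icc 1 k)

/-- `degree m w j n k` is the degree `d_j(n+1, k)` of vertex `j` after the first `k` half-edges of
vertex `n + 1` have been attached; in particular `d_j(n+1, 0) = d_j(n)`. -/
def degree (m : ℕ) (w : ℕ → ℕ → ℕ) (j n k : ℕ) : ℕ :=
  ((placed m n k).filter fun p => j ∈ edge w p.1 p.2).card

/-- The natural filtration `F_{n+1,k}` of the graph process: the σ-algebra generated by the edges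
present after the first `k` half-edges of vertex `n + 1` have been attached. -/
@[reducible] def history {Ω : Type*} (m : ℕ) (w : ℕ → ℕ → Ω → ℕ) (n k : ℕ) : MeasurableSpace Ω :=
  ⨆ p ∈ placed m n k, MeasurableSpace.comap (fun ω => edge (fun r l => w r l ω) p.1 p.2) ⊤

/-- The normalizing constant `D_{n+1,k} = ∑_{j ≤ n} (δ + d_j(n+1,k))^{-α}`. -/
def normalizer (m : ℕ) (α δ : ℝ) (w : ℕ → ℕ → ℕ) (n k : ℕ) : ℝ :=
  ∑ j ∈ Finset.Icc 1 n, 1 / (δ + (degree m w j n k : ℝ)) ^ α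

/-- The inverse power law de-preferential attachment graph with `m` half-edges per vertex,
exponent `α` and shift `δ`: conditionally on the past, the half-edge `(n+1, k+1)` is attached to
the vertex `i ≤ n` with probability `D_{n+1,k}⁻¹ (δ + d_i(n+1,k))^{-α}`. -/
structure IsInverseDePrefGraph {Ω : Type*} [MeasurableSpace Ω] (m : ℕ) (α δ : ℝ)
    (w : ℕ → ℕ → Ω → ℕ) (Q : Measure Ω) : Prop where
  measurable : ∀ r l, Measurable (w r l)
  attach : ∀ n k i : ℕ, 1 ≤ n → k < m → 1 ≤ i → i ≤ n →
    Q⟦{ω | w (n + 1) (k + 1) ω = i} | history m w n k⟧ =ᵐ[Q] fun ω =>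
      (normalizer m α δ (fun r l => w r l ω) n k)⁻¹ *
        (1 / (δ + (degree m (fun r l => w r l ω) i n k : ℝ)) ^ α)

/-! ### Pure birth processes -/

/-- The first time at which the path `z` is at level `a` or above. -/
def birthTime (z : ℝ≥0 → ℕ) (a : ℕ) : ℝ≥0 := sInf {t | a ≤ z t}

/-- A pure birth process started from `m` with birth rates `rate i`, `i ≥ m`: almost surely the
path starts at `m`, is nondecreasing and right-continuous and passes through every state `a ≥ m`;
the holding times in the states `m, m+1, …` are independent, and the one in state `i` is
exponential with parameter `rate i`. -/
structure IsPureBirthProcess {Ω : Type*} [MeasurableSpace Ω] (m : ℕ) (rate : ℕ → ℝ)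
    (Z : ℝ≥0 → Ω → ℕ) (P : Measure Ω) : Prop where
  measurable : ∀ t, Measurable (Z t)
  init : ∀ᵐ ω ∂P, Z 0 ω = m
  mono : ∀ᵐ ω ∂P, Monotone fun t => Z t ω
  rightCont : ∀ᵐ ω ∂P, ∀ t, ContinuousWithinAt (fun s => Z s ω) (Set.Ici t) t
  visits : ∀ᵐ ω ∂P, ∀ a, m ≤ a → ∃ t, Z t ω = a
  indep : iIndepFun (fun (i : ℕ) ω =>
    (birthTime (fun t => Z t ω) (m + i + 1) : ℝ) - birthTime (fun t => Z t ω) (m + i)) P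
  law : ∀ i : ℕ, HasLaw (fun ω =>
    (birthTime (fun t => Z t ω) (m + i + 1) : ℝ) - birthTime (fun t => Z t ω) (m + i))
    (expMeasure (rate (m + i))) P

/-! ### The embedding

Here `z j`, `j ≥ 1`, are the paths of the birth processes, and `z j` is started at time
`start j`, so that its value at time `t ≥ start j` is `z j (t - start j)`. -/

/-- The waiting time after `σ` until the next birth in any of the first `n` processes. -/
def gap (z : ℕ → ℝ≥0 → ℕ) (start : ℕ → ℝ≥0) (n : ℕ) (σ : ℝ≥0) : ℝ≥0 :=
  sInf {s | 0 < s ∧ ∃ j, 1 ≤ j ∧ j ≤ n ∧ z j (σ - start j) < z j (σ + s - start j)}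

/-- The time of the `k`-th birth after `start n` in the first `n` processes. -/
def clock (z : ℕ → ℝ≥0 → ℕ) (start : ℕ → ℝ≥0) (n : ℕ) : ℕ → ℝ≥0
  | 0 => start n
  | k + 1 => clock z start n k + gap z start n (clock z start n k)

/-- The starting times: `τ_1 = 0`, and `τ_{n+1}` is the time of the `m`-th birth after `τ_n` in the
processes `1, …, n`, which are started at `τ_1, …, τ_n`.  (`τ_0 = 0` is not used.) -/
def tau (m : ℕ) (z : ℕ → ℝ≥0 → ℕ) : ℕ → ℝ≥0
  | 0 => 0
  | 1 => 0
  | n + 2 => clock z (fun j => if _h : j ≤ n + 1 then tau m z j else 0) (n + 1) m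
  termination_by n => n

/-- `waiting m z n k` is `T_k^{(n+1)}`, for `k ≥ 1`: the waiting time between the `(k-1)`-st and
the `k`-th birth after `τ_n` in the first `n` processes. -/
def waiting (m : ℕ) (z : ℕ → ℝ≥0 → ℕ) (n k : ℕ) : ℝ≥0 :=
  gap z (tau m z) n (clock z (tau m z) n (k - 1))

/-- `embDegree m z j n k` is
`d̃_j(n+1, k) = Z_j(τ_n + T_1^{(n+1)} + ⋯ + T_k^{(n+1)} - τ_j)`, for `1 ≤ j ≤ n`. -/
def embDegree (m : ℕ) (z : ℕ → ℝ≥0 → ℕ) (j n k : ℕ) : ℕ :=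
  z j (tau m z n + ∑ l ∈ Finset.Icc 1 k, waiting m z n l - tau m z j)

theorem clock_congr (z : ℕ → ℝ≥0 → ℕ) {s s' : ℕ → ℝ≥0} {n : ℕ} (hn : 1 ≤ n)
    (h : ∀ j, 1 ≤ j → j ≤ n → s j = s' j) (k : ℕ) : clock z s n k = clock z s' n k := by
  have hg : ∀ σ, gap z s n σ = gap z s' n σ := by
    intro σ
    unfold gap
    congr 1
    ext t
    simp only [Set.mem_ofPred_eq]
    refine and_congr_right fun _ => exists_congr fun j => ?_
    refine and_congr_right fun h1 => and_congr_right fun h2 => ?_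
    rw [h j h1 h2]
  induction k with
  | zero => exact h n hn le_rfl
  | succ k ih => simp only [clock, ih, hg]

theorem clock_tau (m : ℕ) (z : ℕ → ℝ≥0 → ℕ) (n k : ℕ) :
    clock z (tau m z) n k = tau m z n + ∑ l ∈ Finset.Icc 1 k, waiting m z n l := by
  induction k with
  | zero => simp [clock]
  | succ k ih =>
    rw [Finset.sum_Icc_succ_top (by omega), ← add_assoc, ← ih]
    simp [clock, waiting]

theorem tau_one (m : ℕ) (z : ℕ → ℝ≥0 → ℕ) : tau m z 1 = 0 := by
  rw [tau]

/-- `τ_{n+1} - τ_n = T_1^{(n+1)} + ⋯ + T_m^{(n+1)}`. -/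
theorem tau_succ (m : ℕ) (z : ℕ → ℝ≥0 → ℕ) (n : ℕ) (hn : 1 ≤ n) :
    tau m z (n + 1) = tau m z n + ∑ l ∈ Finset.Icc 1 m, waiting m z n l := by
  obtain ⟨n, rfl⟩ : ∃ k, n = k + 1 := ⟨n - 1, by omega⟩
  rw [← clock_tau, tau]
  exact clock_congr z hn (fun j _ h2 => by simp [h2]) m

/-- The index set `{(n, j, k) : n ≥ 2, 1 ≤ j ≤ n, 0 ≤ k ≤ m - 1}` of the degree sequences. -/
abbrev Index (m : ℕ) : Type :=
  {p : ℕ × ℕ × ℕ // 2 ≤ p.1 ∧ 1 ≤ p.2.1 ∧ p.2.1 ≤ p.1 ∧ p.2.2 < m}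

end DePref

end

namespace DePref

open scoped ENNReal

/-! ### Competing exponential clocks -/

/-! Almost surely, both degree arrays are the same function `countDegree` of a sequence of naturals.
For the graph this sequence (`attachSeq`) lists the vertices that receive the successive half-edges;
for the embedding (`ringRow`) it lists the processes that give the successive births. In both,
labels are shifted down by one. It therefore suffices that the two sequences have the same law, and
for that it suffices that every initial segment has the same probability
(`ext_of_initial_segments`).

The holding times form an array of independent exponential clocks, with row `j` belonging to process
`j + 1`. The next birth is the first ring among the heads of the running rows. Row `c` wins this
race with probability equal to its rate divided by the total rate. By lack of memory, given the
winner, the remaining times are again independent exponential clocks, with row `c` moved on by one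
place (`map_advance_restrict_isFirst`). Rows not yet started are left untouched. Iteration gives a
product of factors `ringProb` (`expArray_ringRow`).

A row that has rung `d` times has a head of rate `(m + d + δ)^{-α}`, and `m + d` is the degree of
the corresponding vertex. Hence the factors are the attachment probabilities, and the graph yields
the same product (`IsInverseDePrefGraph.measure_attachSeq`). The link between births and rings is
pathwise: `remainingSpec`, `clock_eq_ringTime` and `embDegree_eq_countDegree`. -/

theorem lintegral_expMeasure (r : ℝ) {f : ℝ → ℝ≥0∞} (hf : Measurable f) :
    ∫⁻ x, f x ∂expMeasure r = ∫⁻ x, exponentialPDF r x * f x := by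
  have hm : Measurable (exponentialPDF r) := (measurable_exponentialPDFReal r).ennreal_ofReal
  exact lintegral_withDensity_eq_lintegral_mul _ hm hf

/-- This is the chance that a clock of rate `r` beats competitors of total rate `b`. The integrand
times the density is a multiple of the density of rate `r + b`. -/
theorem lintegral_exp_neg_mul_expMeasure {r b : ℝ} (hr : 0 < r) (hb : 0 ≤ b) :
    ∫⁻ u, ENNReal.ofReal (Real.exp (-(b * u))) ∂expMeasure r = ENNReal.ofReal (r / (r + b)) := by
  have hrb : 0 < r + b := by linarith
  rw [lintegral_expMeasure r (by fun_prop)]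
  have h : ∀ u, exponentialPDF r u * ENNReal.ofReal (Real.exp (-(b * u)))
      = ENNReal.ofReal (r / (r + b)) * exponentialPDF (r + b) u := by
    intro u
    rcases lt_or_ge u 0 with hu | hu
    · simp [exponentialPDF_of_neg hu]
    · rw [exponentialPDF_of_nonneg hu, exponentialPDF_of_nonneg hu,
        ← ENNReal.ofReal_mul (by positivity), ← ENNReal.ofReal_mul (by positivity)]
      congr 1
      rw [mul_assoc, ← Real.exp_add, ← mul_assoc, div_mul_cancel₀ _ hrb.ne']
      ring_nf
  simp_rw [h]
  have hm : Measurable (exponentialPDF (r + b)) :=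
    (measurable_exponentialPDFReal _).ennreal_ofReal
  rw [lintegral_const_mul _ hm, lintegral_exponentialPDF_eq_one hrb, mul_one]

theorem ae_pos_expMeasure (r : ℝ) : ∀ᵐ x ∂expMeasure r, 0 < x := by
  have hm : Measurable (exponentialPDF r) := (measurable_exponentialPDFReal r).ennreal_ofReal
  rw [expMeasure, gammaMeasure]
  change ∀ᵐ x ∂(volume.withDensity (exponentialPDF r)), 0 < x
  rw [ae_withDensity_iff hm]
  have h0 : ∀ᵐ x : ℝ, x ≠ 0 := by simp [ae_iff]
  filter_upwards [h0] with x hx hp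
  by_contra hcon
  exact hp (exponentialPDF_of_neg (lt_of_le_of_ne (not_lt.mp hcon) hx))

/-- The exponential distribution is memoryless. -/
theorem expMeasure_memoryless {r u : ℝ} (hu : 0 ≤ u) {t : Set ℝ}
    (ht : MeasurableSet t) :
    expMeasure r {x | u < x ∧ x - u ∈ t}
      = ENNReal.ofReal (Real.exp (-(r * u))) * expMeasure r t := by
  have hS : MeasurableSet {x : ℝ | u < x ∧ x - u ∈ t} :=
    measurableSet_Ioi.inter ((measurable_id.sub_const u) ht)
  rw [← lintegral_indicator_one hS, ← lintegral_indicator_one ht,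
    lintegral_expMeasure r (measurable_one.indicator hS),
    lintegral_expMeasure r (measurable_one.indicator ht),
    ← lintegral_const_mul _ (by
      exact (measurable_exponentialPDFReal r).ennreal_ofReal.mul (measurable_one.indicator ht)),
    -- Translating by `u` reduces the claim to a pointwise one: for positive `x` the density at `x +
    -- u` is `exp (-(r * u))` times the density at `x`.
    ← lintegral_add_right_eq_self _ u]
  refine lintegral_congr_ae ?_
  -- At `x = 0` the strict inequality `u < x + u` fails while the density need not vanish, so this
  -- point is discarded.
  have h0 : ∀ᵐ x : ℝ, x ≠ 0 := by simp [ae_iff]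
  filter_upwards [h0] with x hx
  rcases lt_or_gt_of_ne hx with hx | hx
  · have : x + u ∉ {x : ℝ | u < x ∧ x - u ∈ t} := fun h => by
      have := h.1; linarith
    simp [Set.indicator_of_notMem this, exponentialPDF_of_neg hx]
  · by_cases hxt : x ∈ t
    · have : x + u ∈ {x : ℝ | u < x ∧ x - u ∈ t} := ⟨by linarith, by simpa using hxt⟩
      rw [Set.indicator_of_mem this, Set.indicator_of_mem hxt,
        exponentialPDF_of_nonneg hx.le, exponentialPDF_of_nonneg (by linarith)]
      simp only [Pi.one_apply, mul_one]
      rw [← ENNReal.ofReal_mul (by positivity), mul_left_comm, ← Real.exp_add]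
      ring_nf
    · have : x + u ∉ {x : ℝ | u < x ∧ x - u ∈ t} := fun h => hxt (by simpa using h.2)
      simp [Set.indicator_of_notMem this, Set.indicator_of_notMem hxt]

/-- A box in a product space whose sides depend on one further coordinate. -/
theorem infinitePi_pi_of_coordinate {ι : Type*} {X : ι → Type*} [∀ i, MeasurableSpace (X i)]
    (μ : ∀ i, Measure (X i)) [∀ i, IsProbabilityMeasure (μ i)] {i₀ : ι} {F : Finset ι}
    (hi₀ : i₀ ∉ F) {B : X i₀ → ∀ i, Set (X i)}
    (hB : ∀ i ∈ F, MeasurableSet {p : X i₀ × X i | p.2 ∈ B p.1 i}) :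
    Measure.infinitePi μ {y | ∀ i ∈ F, y i ∈ B (y i₀) i}
      = ∫⁻ u, ∏ i ∈ F, μ i (B u i) ∂μ i₀ := by
  classical
  have hind : iIndepFun (fun i (y : ∀ i, X i) => y i) (Measure.infinitePi μ) :=
    iIndepFun_infinitePi (X := fun i x => x) (fun i => measurable_id)
  have h2 : IndepFun (fun y : ∀ i, X i => y i₀) (fun y (i : F) => y i) (Measure.infinitePi μ) :=
    (hind.indepFun_finset {i₀} F (by simpa using hi₀) (fun i => measurable_pi_apply i)).comp
      (measurable_pi_apply (⟨i₀, by simp⟩ : ({i₀} : Finset ι))) measurable_id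
  have hmap := (indepFun_iff_map_prod_eq_prod_map_map (by fun_prop : Measurable _).aemeasurable
    (by fun_prop : Measurable _).aemeasurable).1 h2
  have hS : MeasurableSet {p : X i₀ × (∀ i : F, X i) | ∀ i : F, p.2 i ∈ B p.1 i} := by
    rw [Set.ofPred_forall]
    refine MeasurableSet.iInter fun i => ?_
    have hg : Measurable fun p : X i₀ × (∀ i : F, X i) => (p.1, p.2 i) := by fun_prop
    exact hg (hB i i.2)
  have hpre : {y : ∀ i, X i | ∀ i ∈ F, y i ∈ B (y i₀) i}
      = (fun y : ∀ i, X i => (y i₀, fun i : F => y i)) ⁻¹'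
        {p : X i₀ × (∀ i : F, X i) | ∀ i : F, p.2 i ∈ B p.1 i} := by
    ext y; simp
  rw [hpre, ← Measure.map_apply (by fun_prop) hS, hmap, Measure.prod_apply hS,
    (measurePreserving_eval_infinitePi μ i₀).map_eq]
  refine lintegral_congr fun u => ?_
  have hu : ∀ i ∈ F, MeasurableSet (B u i) := fun i hi =>
    (measurable_prodMk_left (x := u)) (hB i hi)
  rw [← Measure.infinitePi_pi μ hu, Measure.map_apply (by fun_prop) (measurable_prodMk_left hS)]
  congr 1
  ext y; simp [Set.mem_pi]

/-! ### One race between independent exponential clocks. -/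

section Race

variable {J : Type*}

/-- The law of an array of independent exponential clocks. -/
noncomputable def expArray (ρ : J × ℕ → ℝ) : Measure (J × ℕ → ℝ) :=
  Measure.infinitePi fun q => expMeasure (ρ q)

theorem isProbabilityMeasure_expArray {ρ : J × ℕ → ℝ} (hρ : ∀ q, 0 < ρ q) :
    IsProbabilityMeasure (expArray ρ) := by
  have : ∀ q, IsProbabilityMeasure (expMeasure (ρ q)) :=
    fun q => isProbabilityMeasure_expMeasure (hρ q)
  unfold expArray
  infer_instance

variable [DecidableEq J]

/-- The row of clocks `c` moved on by one place. -/
def nextClock (c : J) (q : J × ℕ) : J × ℕ := if q.1 = c then (c, q.2 + 1) else q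

/-- Among the clocks at the heads of the rows in `A`, the one in row `c` rings strictly first. -/
def IsFirst (A : Finset J) (y : J × ℕ → ℝ) (c : J) : Prop :=
  c ∈ A ∧ ∀ j ∈ A, j ≠ c → y (c, 0) < y (j, 0)

/-- The array of remaining times once the head of row `c` has rung: the head of row `c` is removed
and its duration is taken off the heads of the other rows in `A`. -/
def advance (A : Finset J) (c : J) (y : J × ℕ → ℝ) (q : J × ℕ) : ℝ :=
  if q.2 = 0 ∧ q.1 ∈ A ∧ q.1 ≠ c then y q - y (c, 0) else y (nextClock c q)

theorem nextClock_injective (c : J) : Function.Injective (nextClock c) := by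
  rintro ⟨a, i⟩ ⟨b, k⟩ h
  simp only [nextClock] at h
  split_ifs at h <;> simp_all

theorem nextClock_ne (c : J) (q : J × ℕ) : nextClock c q ≠ (c, 0) := by
  obtain ⟨a, i⟩ := q
  simp only [nextClock]
  split_ifs with h <;> simp [h]

theorem IsFirst.unique {A : Finset J} {y : J × ℕ → ℝ} {c c' : J} (h : IsFirst A y c)
    (h' : IsFirst A y c') : c = c' := by
  by_contra hne
  exact lt_asymm (h.2 c' h'.1 (Ne.symm hne)) (h'.2 c h.1 hne)

theorem measurableSet_isFirst (A : Finset J) (c : J) :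
    MeasurableSet {y : J × ℕ → ℝ | IsFirst A y c} := by
  have : {y : J × ℕ → ℝ | IsFirst A y c}
      = {y | c ∈ A} ∩ ⋂ j ∈ A, {y | j ≠ c → y (c, 0) < y (j, 0)} := by
    ext y; simp [IsFirst]
  rw [this]
  refine (MeasurableSet.const _).inter (Finset.measurableSet_biInter _ fun j _ => ?_)
  by_cases hj : j = c
  · simp [hj]
  · simp only [ne_eq, hj, not_false_eq_true, forall_const]
    exact measurableSet_lt (measurable_pi_apply _) (measurable_pi_apply _)

theorem measurable_advance (A : Finset J) (c : J) : Measurable (advance A c) := by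
  refine measurable_pi_lambda _ fun q => ?_
  unfold advance
  split_ifs <;> fun_prop

/-- Condition on the winning time `u = y (c, 0)`. Each competing head exceeds `u` with probability
`exp (-(ρ q * u))` and then has a residual independent of `u`; all other coordinates ignore `u`.
Integrating the product of the survival factors gives the winning probability, and the box factors
out. -/
theorem expArray_isFirst_advance_box {ρ : J × ℕ → ℝ} (hρ : ∀ q, 0 < ρ q) {A : Finset J} {c : J}
    (hc : c ∈ A) (s : Finset (J × ℕ)) {t : J × ℕ → Set ℝ} (ht : ∀ q, MeasurableSet (t q)) :
    expArray ρ {y | IsFirst A y c ∧ ∀ q ∈ s, advance A c y q ∈ t q}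
      = ENNReal.ofReal (ρ (c, 0) / ∑ j ∈ A, ρ (j, 0)) *
        ∏ q ∈ s, expMeasure (ρ (nextClock c q)) (t q) := by
  have hprob : ∀ q, IsProbabilityMeasure (expMeasure (ρ q)) :=
    fun q => isProbabilityMeasure_expMeasure (hρ q)
  -- the heads of the rows competing with row `c`
  set H : Finset (J × ℕ) := (A.erase c).image fun j => (j, 0) with hH
  have memH : ∀ q, q ∈ H ↔ q.2 = 0 ∧ q.1 ∈ A ∧ q.1 ≠ c := by
    rintro ⟨a, i⟩
    simp only [hH, Finset.mem_image, Finset.mem_erase, Prod.mk.injEq]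
    constructor
    · rintro ⟨j, hj, rfl, rfl⟩; exact ⟨rfl, hj.2, hj.1⟩
    · rintro ⟨rfl, h1, h2⟩; exact ⟨a, ⟨h2, h1⟩, rfl, rfl⟩
  have nextH : ∀ q ∈ H, nextClock c q = q := fun q hq => by
    simp [nextClock, ((memH q).1 hq).2.2]
  -- The box is padded by trivial sides, since the race also constrains the heads in `H` that are
  -- not in `s`.
  set t' : J × ℕ → Set ℝ := fun q => if q ∈ s then t q else Set.univ with ht'
  have ht'm : ∀ q, MeasurableSet (t' q) := fun q => by
    simp only [ht']; split_ifs
    · exact ht q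
    · exact MeasurableSet.univ
  set C : ℝ → J × ℕ → Set ℝ := fun u q =>
    if q ∈ H then {x | u < x ∧ x - u ∈ t' q} else t' q with hC
  set e : J × ℕ ↪ J × ℕ := ⟨nextClock c, nextClock_injective c⟩ with he
  have : Nonempty (J × ℕ) := ⟨(c, 0)⟩
  have hinv : ∀ q, Function.invFun (nextClock c) (nextClock c q) = q :=
    Function.leftInverse_invFun (nextClock_injective c)
  -- Coordinate `q` of the advanced array is read off coordinate `nextClock c q` of `y`, which is
  -- never `(c, 0)`. So the event is a box in the other coordinates whose sides depend on `y (c, 0)`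
  -- alone.
  have hevent : {y : J × ℕ → ℝ | IsFirst A y c ∧ ∀ q ∈ s, advance A c y q ∈ t q}
      = {y | ∀ q ∈ (s ∪ H).map e, y q ∈ C (y (c, 0)) (Function.invFun (nextClock c) q)} := by
    ext y
    simp only [Set.mem_ofPred_eq, Finset.mem_map, he, Function.Embedding.coeFn_mk,
      forall_exists_index, and_imp, forall_apply_eq_imp_iff₂, hinv]
    constructor
    · rintro ⟨h1, h2⟩ q hq
      simp only [hC]
      split_ifs with hqH
      · obtain ⟨a1, a2, a3⟩ := (memH q).1 hqH
        obtain ⟨a, i⟩ := q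
        simp only at a1 a2 a3
        subst a1
        rw [nextH _ hqH]
        refine ⟨h1.2 a a2 a3, ?_⟩
        simp only [ht']
        split_ifs with hs
        · have := h2 _ hs
          simpa [advance, a2, a3] using this
        · trivial
      · simp only [ht']
        split_ifs with hs
        · have := h2 _ hs
          rwa [advance, if_neg (fun h => hqH ((memH q).2 h))] at this
        · trivial
    · intro h
      refine ⟨⟨hc, fun j hj hjc => ?_⟩, fun q hq => ?_⟩
      · have hjH : (j, 0) ∈ H := (memH _).2 ⟨rfl, hj, hjc⟩
        have := h (j, 0) (Finset.mem_union_right _ hjH)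
        rw [nextH _ hjH] at this
        simp only [hC, hjH, if_true] at this
        exact this.1
      · have := h q (Finset.mem_union_left _ hq)
        simp only [hC, ht', hq, if_true] at this
        by_cases hqH : q ∈ H
        · rw [if_pos hqH, nextH _ hqH] at this
          rw [advance, if_pos ((memH q).1 hqH)]
          exact this.2
        · rw [if_neg hqH] at this
          rwa [advance, if_neg (fun h => hqH ((memH q).2 h))]
  have hCm : ∀ q, MeasurableSet {p : ℝ × ℝ | p.2 ∈ C p.1 q} := by
    intro q
    simp only [hC]
    split_ifs
    · exact (measurableSet_lt measurable_fst measurable_snd).inter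
        ((measurable_snd.sub measurable_fst) (ht'm q))
    · exact measurable_snd (ht'm q)
  rw [hevent, expArray, infinitePi_pi_of_coordinate (fun q => expMeasure (ρ q))
    (B := fun u q => C u (Function.invFun (nextClock c) q))
    (by simpa [he] using fun a b _ => nextClock_ne c (a, b)) (fun i _ => hCm _)]
  simp only [Finset.prod_map, he, Function.Embedding.coeFn_mk, hinv]
  have hint : ∀ u : ℝ, 0 < u →
      ∏ q ∈ s ∪ H, expMeasure (ρ (nextClock c q)) (C u q)
        = ENNReal.ofReal (Real.exp (-((∑ j ∈ A.erase c, ρ (j, 0)) * u))) *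
          ∏ q ∈ s, expMeasure (ρ (nextClock c q)) (t q) := by
    intro u hu
    have h1 : ∀ q ∈ s ∪ H, expMeasure (ρ (nextClock c q)) (C u q)
        = (if q ∈ H then ENNReal.ofReal (Real.exp (-(ρ q * u))) else 1) *
          expMeasure (ρ (nextClock c q)) (t' q) := by
      intro q _
      simp only [hC]
      split_ifs with hqH
      · rw [nextH q hqH, expMeasure_memoryless hu.le (ht'm q)]
      · rw [one_mul]
    rw [Finset.prod_congr rfl h1, Finset.prod_mul_distrib]
    congr 1
    · rw [Finset.prod_ite_mem, Finset.inter_eq_right.2 Finset.subset_union_right, hH,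
        Finset.prod_image (by intro a _ b _ h; simpa using h),
        ← ENNReal.ofReal_prod_of_nonneg (fun _ _ => by positivity), ← Real.exp_sum,
        Finset.sum_mul, ← Finset.sum_neg_distrib]
    · have : ∀ q ∈ s ∪ H, q ∉ s → expMeasure (ρ (nextClock c q)) (t' q) = 1 := by
        intro q _ hq
        simp only [ht', hq, if_false]
        exact measure_univ
      rw [← Finset.prod_subset Finset.subset_union_left this]
      exact Finset.prod_congr rfl fun q hq => by simp [ht', hq]
  have hcongr : ∀ᵐ u ∂expMeasure (ρ (c, 0)),
      ∏ q ∈ s ∪ H, expMeasure (ρ (nextClock c q)) (C u q)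
        = ENNReal.ofReal (Real.exp (-((∑ j ∈ A.erase c, ρ (j, 0)) * u))) *
          ∏ q ∈ s, expMeasure (ρ (nextClock c q)) (t q) := by
    filter_upwards [ae_pos_expMeasure (ρ (c, 0))] with u hu using hint u hu
  rw [lintegral_congr_ae hcongr, lintegral_mul_const _ (by fun_prop),
    lintegral_exp_neg_mul_expMeasure (hρ _) (Finset.sum_nonneg fun j _ => (hρ _).le),
    Finset.add_sum_erase A (fun j => ρ (j, 0)) hc]

/-- When the head of row `c` rings first, the remaining times are again independent exponential
clocks. -/
theorem map_advance_restrict_isFirst {ρ : J × ℕ → ℝ} (hρ : ∀ q, 0 < ρ q) {A : Finset J} {c : J}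
    (hc : c ∈ A) :
    ((expArray ρ).restrict {y | IsFirst A y c}).map (advance A c)
      = ENNReal.ofReal (ρ (c, 0) / ∑ j ∈ A, ρ (j, 0)) • expArray (ρ ∘ nextClock c) := by
  have hprob : ∀ q, IsProbabilityMeasure (expMeasure ((ρ ∘ nextClock c) q)) :=
    fun q => isProbabilityMeasure_expMeasure (hρ _)
  set p := ENNReal.ofReal (ρ (c, 0) / ∑ j ∈ A, ρ (j, 0)) with hp
  have hsum : 0 < ∑ j ∈ A, ρ (j, 0) := Finset.sum_pos (fun j _ => hρ _) ⟨c, hc⟩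
  have hp0 : p ≠ 0 := by
    rw [hp, ENNReal.ofReal_ne_zero_iff]
    exact div_pos (hρ _) hsum
  have hpt : p ≠ ∞ := ENNReal.ofReal_ne_top
  -- Dividing by `p` makes this the product measure, which its values on finite boxes characterize.
  have key : p⁻¹ • ((expArray ρ).restrict {y | IsFirst A y c}).map (advance A c)
      = expArray (ρ ∘ nextClock c) := by
    refine Measure.eq_infinitePi _ fun s t ht => ?_
    have hbox : MeasurableSet (Set.pi (s : Set (J × ℕ)) t) :=
      MeasurableSet.pi s.countable_toSet fun q _ => ht q
    rw [Measure.smul_apply, Measure.map_apply (measurable_advance A c) hbox,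
      Measure.restrict_apply (measurable_advance A c hbox)]
    have : advance A c ⁻¹' Set.pi (s : Set (J × ℕ)) t ∩ {y | IsFirst A y c}
        = {y | IsFirst A y c ∧ ∀ q ∈ s, advance A c y q ∈ t q} := by
      ext y; simp [Set.mem_pi, and_comm]
    rw [this, expArray_isFirst_advance_box hρ hc s ht, ← hp, smul_eq_mul, ← mul_assoc,
      ENNReal.inv_mul_cancel hp0 hpt, one_mul]
    rfl
  rw [← key, smul_smul, ENNReal.mul_inv_cancel hp0 hpt, one_smul]

theorem expArray_isFirst {ρ : J × ℕ → ℝ} (hρ : ∀ q, 0 < ρ q) {A : Finset J} {c : J}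
    (hc : c ∈ A) :
    expArray ρ {y | IsFirst A y c} = ENNReal.ofReal (ρ (c, 0) / ∑ j ∈ A, ρ (j, 0)) := by
  simpa using expArray_isFirst_advance_box hρ hc ∅ (t := fun _ => Set.univ)
    (fun _ => MeasurableSet.univ)

/-- The events that a given row wins are disjoint and their probabilities add up to one, so ties are
null. -/
theorem ae_exists_isFirst {ρ : J × ℕ → ℝ} (hρ : ∀ q, 0 < ρ q) {A : Finset J}
    (hA : A.Nonempty) : ∀ᵐ y ∂expArray ρ, ∃ c, IsFirst A y c := by
  have := isProbabilityMeasure_expArray hρ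
  have hsum : 0 < ∑ j ∈ A, ρ (j, 0) := Finset.sum_pos (fun j _ => hρ _) hA
  have hU : expArray ρ (⋃ c ∈ A, {y | IsFirst A y c}) = 1 := by
    rw [measure_biUnion_finset (fun c _ c' _ hne => ?_) fun c _ => measurableSet_isFirst A c,
      Finset.sum_congr rfl fun c hc => expArray_isFirst hρ hc,
      ← ENNReal.ofReal_sum_of_nonneg (fun c _ => by have := hρ (c, 0); positivity),
      ← Finset.sum_div, div_self hsum.ne', ENNReal.ofReal_one]
    exact Set.disjoint_left.2 fun y h h' => hne (h.unique h')
  have hm : MeasurableSet (⋃ c ∈ A, {y : J × ℕ → ℝ | IsFirst A y c}) :=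
    Finset.measurableSet_biUnion _ fun c _ => measurableSet_isFirst A c
  have hae := (prob_compl_eq_zero_iff hm).2 hU
  rw [ae_iff]
  refine measure_mono_null (fun y hy => ?_) hae
  simp only [Set.mem_compl_iff, Set.mem_iUnion, not_exists]
  exact fun c _ h => hy ⟨c, h⟩

end Race

/-! ### The sequence of rings -/

open Classical in
/-- The row whose head rings strictly first among those in `A`, and `0` if there is none. -/
noncomputable def firstRow (A : Finset ℕ) (y : ℕ × ℕ → ℝ) : ℕ :=
  if h : ∃ c, IsFirst A y c then h.choose else 0

theorem IsFirst.firstRow_eq {A : Finset ℕ} {y : ℕ × ℕ → ℝ} {c : ℕ} (h : IsFirst A y c) :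
    firstRow A y = c := by
  have hex : ∃ c, IsFirst A y c := ⟨c, h⟩
  rw [firstRow, dif_pos hex]
  exact hex.choose_spec.unique h

theorem measurable_firstRow (A : Finset ℕ) : Measurable (firstRow A) := by
  refine measurable_to_countable' fun c => ?_
  -- The second set accounts for the default value `0` in case of a tie.
  have : firstRow A ⁻¹' {c} = {y | IsFirst A y c} ∪
      ((⋂ c', {y | IsFirst A y c'}ᶜ) ∩ {_y | 0 = c}) := by
    ext y
    simp only [Set.mem_preimage, Set.mem_singleton_iff, Set.mem_union, Set.mem_ofPred_eq,
      Set.mem_inter_iff, Set.mem_iInter, Set.mem_compl_iff]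
    by_cases hex : ∃ c, IsFirst A y c
    · obtain ⟨c', hc'⟩ := hex
      rw [hc'.firstRow_eq]
      exact ⟨fun h => Or.inl (h ▸ hc'), fun h => h.elim (fun h => hc'.unique h)
        (fun h => absurd hc' (h.1 c'))⟩
    · rw [firstRow, dif_neg hex]
      push Not at hex
      simp [hex]
  rw [this]
  exact (measurableSet_isFirst A c).union
    ((MeasurableSet.iInter fun c' => (measurableSet_isFirst A c').compl).inter (.const _))

/-- The array of remaining times after `s` rings, where the rows in `A r` are the running ones
during the `r`-th waiting time. -/
noncomputable def remaining (A : ℕ → Finset ℕ) (x : ℕ × ℕ → ℝ) : ℕ → ℕ × ℕ → ℝ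
  | 0 => x
  | s + 1 => advance (A s) (firstRow (A s) (remaining A x s)) (remaining A x s)

/-- The row in which the `s`-th ring takes place. -/
noncomputable def ringRow (A : ℕ → Finset ℕ) (x : ℕ × ℕ → ℝ) (s : ℕ) : ℕ :=
  firstRow (A s) (remaining A x s)

theorem measurable_remaining (A : ℕ → Finset ℕ) (s : ℕ) :
    Measurable fun x => remaining A x s := by
  induction s with
  | zero => exact measurable_id
  | succ s ih =>
    have h : Measurable fun p : ℕ × (ℕ × ℕ → ℝ) => advance (A s) p.1 p.2 :=
      measurable_from_prod_countable_right fun c => measurable_advance (A s) c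
    exact h.comp (((measurable_firstRow (A s)).comp ih).prodMk ih)

theorem measurable_ringRow (A : ℕ → Finset ℕ) : Measurable (ringRow A) :=
  measurable_pi_lambda _ fun s => (measurable_firstRow (A s)).comp (measurable_remaining A s)

/-- The rates left after the rings in the rows `a 0, …, a (N - 1)`. -/
def shiftedRates (ρ : ℕ × ℕ → ℝ) (a : ℕ → ℕ) (N : ℕ) (q : ℕ × ℕ) : ℝ :=
  ρ (q.1, Nat.count (fun r => a r = q.1) N + q.2)

theorem shiftedRates_succ (ρ : ℕ × ℕ → ℝ) (a : ℕ → ℕ) (N : ℕ) :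
    shiftedRates ρ a (N + 1) = shiftedRates ρ a N ∘ nextClock (a N) := by
  ext ⟨j, i⟩
  simp only [shiftedRates, Function.comp_apply, nextClock, Nat.count_succ]
  by_cases h : j = a N
  · subst h
    simp only [if_true]
    congr 2
    ring
  · simp [h, Ne.symm h]

/-- The probability that row `a N` rings next after the rings in the rows `a 0, …, a (N - 1)`. -/
noncomputable def ringProb (A : ℕ → Finset ℕ) (ρ : ℕ × ℕ → ℝ) (a : ℕ → ℕ) (N : ℕ) : ℝ≥0∞ :=
  if a N ∈ A N then ENNReal.ofReal
    (shiftedRates ρ a N (a N, 0) / ∑ j ∈ A N, shiftedRates ρ a N (j, 0)) else 0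

/-- The arrays in which the first `N` rings take place, strictly ordered, in the rows
`a 0, …, a (N - 1)`. -/
def ringEvent (A : ℕ → Finset ℕ) (a : ℕ → ℕ) (N : ℕ) : Set (ℕ × ℕ → ℝ) :=
  {x | ∀ s < N, IsFirst (A s) (remaining A x s) (a s)}

theorem ringEvent_succ (A : ℕ → Finset ℕ) (a : ℕ → ℕ) (N : ℕ) :
    ringEvent A a (N + 1)
      = (fun x => remaining A x N) ⁻¹' {y | IsFirst (A N) y (a N)} ∩ ringEvent A a N := by
  ext x
  simp only [ringEvent, Set.mem_ofPred_eq, Set.mem_inter_iff, Set.mem_preimage]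
  exact ⟨fun h => ⟨h N (Nat.lt_succ_self N), fun s hs => h s (hs.trans (Nat.lt_succ_self N))⟩,
    fun h s hs => (Nat.lt_succ_iff_lt_or_eq.1 hs).elim (h.2 s) (fun e => e ▸ h.1)⟩

theorem measurableSet_ringEvent (A : ℕ → Finset ℕ) (a : ℕ → ℕ) (N : ℕ) :
    MeasurableSet (ringEvent A a N) := by
  induction N with
  | zero => simp [ringEvent]
  | succ N ih =>
    rw [ringEvent_succ]
    exact (measurable_remaining A N (measurableSet_isFirst _ _)).inter ih

/-- Given the rows of the first `N` rings, the remaining times are independent exponential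
clocks. -/
theorem map_remaining_restrict_ringEvent {ρ : ℕ × ℕ → ℝ} (hρ : ∀ q, 0 < ρ q)
    (A : ℕ → Finset ℕ) (a : ℕ → ℕ) (N : ℕ) :
    ((expArray ρ).restrict (ringEvent A a N)).map (fun x => remaining A x N)
      = (∏ s ∈ Finset.range N, ringProb A ρ a s) • expArray (shiftedRates ρ a N) := by
  induction N with
  | zero =>
    have h1 : ringEvent A a 0 = Set.univ := by simp [ringEvent]
    have h2 : shiftedRates ρ a 0 = ρ := by ext ⟨j, i⟩; simp [shiftedRates]
    have h3 : (fun x => remaining A x 0) = id := rfl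
    simp [h1, h2, h3]
  | succ N ih =>
    have hF := measurableSet_isFirst (A N) (a N)
    have hE : ((expArray ρ).restrict (ringEvent A a (N + 1))).map (fun x => remaining A x (N + 1))
        = ((((expArray ρ).restrict (ringEvent A a N)).map (fun x => remaining A x N)).restrict
            {y | IsFirst (A N) y (a N)}).map (advance (A N) (a N)) := by
      rw [Measure.restrict_map (measurable_remaining A N) hF,
        Measure.restrict_restrict (measurable_remaining A N hF), ← ringEvent_succ,
        Measure.map_map (measurable_advance _ _) (measurable_remaining A N)]
      refine Measure.map_congr ?_
      filter_upwards [ae_restrict_mem (measurableSet_ringEvent A a (N + 1))] with x hx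
      rw [remaining, (hx N (Nat.lt_succ_self N)).firstRow_eq]
      rfl
    rw [hE, ih, Measure.restrict_smul, Measure.map_smul, Finset.prod_range_succ]
    by_cases ha : a N ∈ A N
    · rw [map_advance_restrict_isFirst (ρ := shiftedRates ρ a N) (fun q => hρ _) ha, smul_smul,
        shiftedRates_succ, ringProb, if_pos ha]
    · have : {y : ℕ × ℕ → ℝ | IsFirst (A N) y (a N)} = ∅ :=
        Set.eq_empty_of_forall_notMem fun y hy => ha hy.1
      simp [this, ringProb, ha]

/-- This compares the total masses in `map_remaining_restrict_ringEvent`. -/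
theorem expArray_ringEvent {ρ : ℕ × ℕ → ℝ} (hρ : ∀ q, 0 < ρ q)
    (A : ℕ → Finset ℕ) (a : ℕ → ℕ) (N : ℕ) :
    expArray ρ (ringEvent A a N) = ∏ s ∈ Finset.range N, ringProb A ρ a s := by
  have := isProbabilityMeasure_expArray (ρ := shiftedRates ρ a N) fun q => hρ _
  have h := congrArg (fun μ => μ Set.univ) (map_remaining_restrict_ringEvent hρ A a N)
  simpa [Measure.map_apply (measurable_remaining A N)] using h

/-- Almost surely there are no ties. -/
theorem ae_forall_exists_isFirst {ρ : ℕ × ℕ → ℝ} (hρ : ∀ q, 0 < ρ q) {A : ℕ → Finset ℕ}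
    (hA : ∀ s, (A s).Nonempty) :
    ∀ᵐ x ∂expArray ρ, ∀ s, ∃ c, IsFirst (A s) (remaining A x s) c := by
  have key : ∀ (N : ℕ) (a : ℕ → ℕ), ∀ᵐ x ∂expArray ρ, x ∈ ringEvent A a N →
      ∃ c, IsFirst (A N) (remaining A x N) c := by
    intro N a
    have h := Measure.ae_smul_measure
      (ae_exists_isFirst (ρ := shiftedRates ρ a N) (fun q => hρ _) (hA N))
      (∏ s ∈ Finset.range N, ringProb A ρ a s)
    rw [← map_remaining_restrict_ringEvent hρ A a N] at h
    exact (ae_restrict_iff' (measurableSet_ringEvent A a N)).1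
      (ae_of_ae_map (measurable_remaining A N).aemeasurable h)
  -- Only initial segments matter and there are countably many of them, so a single null set serves
  -- for all.
  have key' : ∀ᵐ x ∂expArray ρ, ∀ (N : ℕ) (b : Fin N → ℕ),
      x ∈ ringEvent A (fun s => if h : s < N then b ⟨s, h⟩ else 0) N →
      ∃ c, IsFirst (A N) (remaining A x N) c :=
    ae_all_iff.2 fun N => ae_all_iff.2 fun b => key N _
  filter_upwards [key'] with x hx s
  induction s using Nat.strong_induction_on with
  | _ s ih =>
    -- The prefix used is the one that `x` itself realizes; by induction its rings are without ties.
    refine hx s (fun r => ringRow A x r) fun r hr => ?_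
    obtain ⟨c, hc⟩ := ih r hr
    simp only [hr, dif_pos, ringRow]
    rwa [hc.firstRow_eq]

/-- The law of the sequence of ringing rows. -/
theorem expArray_ringRow {ρ : ℕ × ℕ → ℝ} (hρ : ∀ q, 0 < ρ q) {A : ℕ → Finset ℕ}
    (hA : ∀ s, (A s).Nonempty) (a : ℕ → ℕ) (N : ℕ) :
    expArray ρ {x | ∀ s < N, ringRow A x s = a s} = ∏ s ∈ Finset.range N, ringProb A ρ a s := by
  rw [← expArray_ringEvent hρ]
  refine measure_congr ?_
  filter_upwards [ae_forall_exists_isFirst hρ hA] with x hx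
  refine propext (forall₂_congr fun s _ => ?_)
  obtain ⟨c, hc⟩ := hx s
  rw [ringRow, hc.firstRow_eq]
  exact ⟨fun h => h ▸ hc, fun h => hc.unique h⟩

/-- A finite measure on sequences of naturals is determined by its values on the sets of sequences
with given initial segments. -/
theorem ext_of_initial_segments {μ ν : Measure (ℕ → ℕ)} [IsFiniteMeasure μ]
    (h : ∀ (a : ℕ → ℕ) (N : ℕ), μ {c | ∀ s < N, c s = a s} = ν {c | ∀ s < N, c s = a s}) :
    μ = ν := by
  set C : Set (Set (ℕ → ℕ)) := {S | ∃ (a : ℕ → ℕ) (N : ℕ), S = {c | ∀ s < N, c s = a s}} with hC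
  refine ext_of_generate_finite C ?_ ?_ ?_ ?_
  · refine le_antisymm (iSup_le fun s => ?_) (MeasurableSpace.generateFrom_le ?_)
    · rw [← measurable_iff_comap_le]
      refine @measurable_to_countable' _ _ _ _ (MeasurableSpace.generateFrom C) _ fun i => ?_
      -- Fixing one coordinate is a countable union over the prefixes of length `s + 1` ending in
      -- `i`.
      have : (fun c : ℕ → ℕ => c s) ⁻¹' {i} = ⋃ b : {b : Fin (s + 1) → ℕ // b (Fin.last s) = i},
          {c | ∀ r < s + 1, c r = if h : r < s + 1 then b.1 ⟨r, h⟩ else 0} := by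
        ext c
        simp only [Set.mem_preimage, Set.mem_singleton_iff, Set.mem_iUnion, Set.mem_ofPred_eq,
          Subtype.exists]
        constructor
        · intro hc
          refine ⟨fun r => c r, by simpa using hc, fun r hr => by simp [hr]⟩
        · rintro ⟨b, hb, hcb⟩
          rw [hcb s (Nat.lt_succ_self s), dif_pos (Nat.lt_succ_self s), ← hb]
          rfl
      rw [this]
      exact MeasurableSet.iUnion fun b => MeasurableSpace.measurableSet_generateFrom ⟨_, _, rfl⟩
    · rintro S ⟨a, N, rfl⟩
      simp only [Set.ofPred_forall]
      exact MeasurableSet.iInter fun s => MeasurableSet.iInter fun _ =>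
        measurableSet_eq_fun (measurable_pi_apply s) measurable_const
  · rintro _ ⟨a, N, rfl⟩ _ ⟨b, M, rfl⟩ ⟨c, hc1, hc2⟩
    -- Two cylinders with a common point `c` meet in the cylinder of the longer prefix of `c`.
    refine ⟨c, max N M, ?_⟩
    ext e
    simp only [Set.mem_inter_iff, Set.mem_ofPred_eq] at hc1 hc2 ⊢
    constructor
    · rintro ⟨h1, h2⟩ s hs
      rcases lt_max_iff.1 hs with hs | hs
      · rw [h1 s hs, hc1 s hs]
      · rw [h2 s hs, hc2 s hs]
    · intro he
      exact ⟨fun s hs => by rw [he s (lt_max_of_lt_left hs), hc1 s hs],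
        fun s hs => by rw [he s (lt_max_of_lt_right hs), hc2 s hs]⟩
  · rintro _ ⟨a, N, rfl⟩
    exact h a N
  · simpa using h 0 0

/-! ### The graph process as a sequence of attachments -/

/-- The `s`-th half-edge, counted from `0`, among those of the vertices `2, 3, …`. -/
def halfEdge (m s : ℕ) : ℕ × ℕ := (s / m + 2, s % m + 1)

theorem halfEdge_injective {m : ℕ} : Function.Injective (halfEdge m) := by
  intro s s' h
  simp only [halfEdge, Prod.mk.injEq, Nat.add_right_cancel_iff] at h
  rw [← Nat.div_add_mod s m, ← Nat.div_add_mod s' m, h.1, h.2]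

theorem div_of_lt {m k : ℕ} (hk : k < m) (n : ℕ) : (n * m + k) / m = n := by
  rw [mul_comm, Nat.mul_add_div (by omega), Nat.div_eq_of_lt hk, add_zero]

theorem mod_of_lt {m k : ℕ} (hk : k < m) (n : ℕ) : (n * m + k) % m = k := by
  rw [mul_comm, Nat.mul_add_mod, Nat.mod_eq_of_lt hk]

theorem halfEdge_apply {m k : ℕ} (hk : k < m) (n : ℕ) :
    halfEdge m (n * m + k) = (n + 2, k + 1) := by
  simp [halfEdge, div_of_lt hk, mod_of_lt hk]

/-- Half-edges are numbered lexicographically, in the order of attachment; the cases compare the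
block `s / m` with `n`. -/
theorem lt_iff_halfEdge_mem_placed {m n k s : ℕ} (hk : k < m) :
    s < n * m + k ↔ halfEdge m s ∈ placed m (n + 1) k := by
  have hm : s % m < m := Nat.mod_lt s (by omega)
  simp only [placed, halfEdge, Finset.mem_union, Finset.mem_product, Finset.mem_Icc,
    Finset.mem_singleton]
  have h := Nat.div_add_mod' s m
  generalize s / m = d at *
  have hs : d < n ∨ d = n ∨ n + 1 ≤ d := by omega
  rcases hs with hs | hs | hs
  · have : (d + 1) * m ≤ n * m := Nat.mul_le_mul_right m hs
    have : d * m + m ≤ n * m := by rw [← Nat.succ_mul]; exact this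
    omega
  · rw [hs] at h
    omega
  · have : (n + 1) * m ≤ d * m := Nat.mul_le_mul_right m hs
    have : n * m + m ≤ d * m := by rw [← Nat.succ_mul]; exact this
    omega

theorem exists_halfEdge_of_mem_placed {m n k r l : ℕ} (hk : k < m) (hr : 2 ≤ r)
    (h : (r, l) ∈ placed m n k) : ∃ s, halfEdge m s = (r, l) := by
  simp only [placed, Finset.mem_union, Finset.mem_product, Finset.mem_Icc,
    Finset.mem_singleton] at h
  refine ⟨(r - 2) * m + (l - 1), ?_⟩
  rw [halfEdge_apply (by omega)]
  ext <;> simp only <;> omega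

theorem own_halfEdges_subset (m : ℕ) (w : ℕ → ℕ → ℕ) {j n : ℕ} (k : ℕ) (hj : 1 ≤ j)
    (hjn : j ≤ n) :
    {j} ×ˢ Finset.Icc 1 m ⊆ (placed m n k).filter fun p => j ∈ edge w p.1 p.2 := by
  rintro ⟨r, l⟩ h
  simp only [Finset.mem_product, Finset.mem_singleton, Finset.mem_Icc] at h
  obtain ⟨rfl, hl⟩ := h
  rw [Finset.mem_filter]
  constructor
  · simp [placed, hj, hjn, hl]
  · simp only [edge]
    split_ifs with h1 <;> simp [h1]

theorem le_degree (m : ℕ) (w : ℕ → ℕ → ℕ) {j n : ℕ} (k : ℕ) (hj : 1 ≤ j) (hjn : j ≤ n) :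
    m ≤ degree m w j n k := by
  have := Finset.card_le_card (own_halfEdges_subset m w k hj hjn)
  simpa [degree] using this

/-- The degree of a vertex counts its own half-edges and those attached to it. -/
theorem degree_eq_count {m : ℕ} {w : ℕ → ℕ → ℕ} {n k j : ℕ} (hk : k < m)
    (hw : ∀ s < n * m + k, w (halfEdge m s).1 (halfEdge m s).2 < (halfEdge m s).1)
    (hj : 1 ≤ j) (hjn : j ≤ n + 1) :
    degree m w j (n + 1) k
      = m + Nat.count (fun s => w (halfEdge m s).1 (halfEdge m s).2 = j) (n * m + k) := by
  classical
  have hsplit : ((placed m (n + 1) k).filter fun p => j ∈ edge w p.1 p.2)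
      = ({j} ×ˢ Finset.Icc 1 m) ∪
        ((Finset.range (n * m + k)).filter
          fun s => w (halfEdge m s).1 (halfEdge m s).2 = j).image (halfEdge m) := by
    refine Finset.Subset.antisymm ?_
      (Finset.union_subset (own_halfEdges_subset m w k hj hjn) ?_)
    · rintro ⟨r, l⟩ h
      simp only [Finset.mem_filter] at h
      obtain ⟨hp, he⟩ := h
      simp only [Finset.mem_union, Finset.mem_product, Finset.mem_singleton, Finset.mem_Icc,
        Finset.mem_image, Finset.mem_filter, Finset.mem_range]
      have hp' := hp
      simp only [placed, Finset.mem_union, Finset.mem_product, Finset.mem_Icc,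
        Finset.mem_singleton] at hp'
      by_cases hrj : r = j
      · left; exact ⟨hrj, by omega⟩
      · right
        -- The dangling half-edges of vertex 1 meet no other vertex.
        have hr : r ≠ 1 := by
          rintro rfl
          simp [edge] at he
          omega
        simp only [edge, hr, if_false, Finset.mem_insert, Finset.mem_singleton] at he
        obtain ⟨s, hs⟩ := exists_halfEdge_of_mem_placed hk (by omega) hp
        refine ⟨s, ⟨(lt_iff_halfEdge_mem_placed hk).2 (hs ▸ hp), ?_⟩, hs⟩
        rw [hs]
        exact (he.resolve_left (Ne.symm hrj)).symm
    · intro p hp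
      obtain ⟨s, hs, rfl⟩ := Finset.mem_image.1 hp
      simp only [Finset.mem_filter, Finset.mem_range] at hs
      refine Finset.mem_filter.2 ⟨(lt_iff_halfEdge_mem_placed hk).1 hs.1, ?_⟩
      have : (halfEdge m s).1 ≠ 1 := by simp [halfEdge]
      simp [edge, this, hs.2]
  -- Attachment to strictly older vertices rules out loops, so no half-edge is counted twice.
  have hdisj : Disjoint ({j} ×ˢ Finset.Icc 1 m : Finset (ℕ × ℕ))
      (((Finset.range (n * m + k)).filter
          fun s => w (halfEdge m s).1 (halfEdge m s).2 = j).image (halfEdge m)) := by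
    rw [Finset.disjoint_left]
    intro p hp hp'
    obtain ⟨s, hs, rfl⟩ := Finset.mem_image.1 hp'
    simp only [Finset.mem_filter, Finset.mem_range] at hs
    simp only [Finset.mem_product, Finset.mem_singleton] at hp
    have := hw s hs.1
    omega
  rw [degree, hsplit, Finset.card_union_of_disjoint hdisj,
    Finset.card_image_of_injective _ halfEdge_injective, Nat.count_eq_card_filter_range]
  simp

/-- The vertices present, shifted down by one, when the `s`-th half-edge is attached. -/
def present (m s : ℕ) : Finset ℕ := Finset.range (s / m + 1)

theorem present_nonempty (m s : ℕ) : (present m s).Nonempty := ⟨0, by simp [present]⟩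

/-- The rate in state `i`. -/
noncomputable def birthRate (α δ : ℝ) (i : ℕ) : ℝ := 1 / ((i : ℝ) + δ) ^ α

theorem birthRate_pos {α δ : ℝ} (hδ : -1 < δ) {i : ℕ} (hi : 1 ≤ i) : 0 < birthRate α δ i := by
  have : (1 : ℝ) ≤ i := by exact_mod_cast hi
  have : 0 < (i : ℝ) + δ := by linarith
  unfold birthRate
  positivity

/-- The rates of the clocks of the birth processes started from `m`. -/
noncomputable def clockRates (m : ℕ) (α δ : ℝ) (q : ℕ × ℕ) : ℝ := birthRate α δ (m + q.2)

theorem clockRates_pos {m : ℕ} (hm : 1 ≤ m) {α δ : ℝ} (hδ : -1 < δ) (q : ℕ × ℕ) :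
    0 < clockRates m α δ q := birthRate_pos hδ (by omega)

/-- The degrees of the graph in which the `s`-th half-edge is attached to the vertex `c s + 1`. -/
def countDegree (m : ℕ) (c : ℕ → ℕ) (j n k : ℕ) : ℕ :=
  m + Nat.count (fun s => c s + 1 = j) ((n - 1) * m + k)

theorem measurable_countDegree (m j n k : ℕ) : Measurable fun c => countDegree m c j n k := by
  unfold countDegree
  refine measurable_const.add ?_
  induction (n - 1) * m + k with
  | zero => simp
  | succ N ih =>
    simp only [Nat.count_succ]
    refine ih.add (Measurable.ite ?_ measurable_const measurable_const)
    exact measurableSet_eq_fun ((measurable_pi_apply N).add_const 1) measurable_const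

/-- The history records only the unordered set `{r, w r l}`. For `i ≠ r`, this set equals `{r, i}`
exactly when `w r l = i`. -/
theorem measurableSet_history {Ω : Type*} {m : ℕ} {w : ℕ → ℕ → Ω → ℕ} {n k r l i : ℕ}
    (hp : (r, l) ∈ placed m n k) (hr : r ≠ 1) (hi : i ≠ r) : MeasurableSet[history m w n k] {ω | w r l ω = i} := by
  have hle : MeasurableSpace.comap (fun ω => edge (fun r l => w r l ω) r l) ⊤
      ≤ history m w n k :=
    le_iSup₂_of_le (f := fun p (_ : p ∈ placed m n k) =>
      MeasurableSpace.comap (fun ω => edge (fun r l => w r l ω) p.1 p.2) ⊤) (r, l) hp le_rfl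
  refine hle _ ⟨{{r, i}}, trivial, ?_⟩
  ext ω
  simp only [edge, hr, if_false, Set.mem_preimage, Set.mem_singleton_iff, Set.mem_ofPred_eq]
  constructor
  · intro h
    have : i ∈ ({r, w r l ω} : Finset ℕ) := by rw [h]; simp
    simp only [Finset.mem_insert, Finset.mem_singleton] at this
    exact (this.resolve_left hi).symm
  · rintro rfl; rfl

/-! ### Law of the attachment sequence of the graph. -/

section Graph

variable {Ω : Type*} [mΩ : MeasurableSpace Ω] {m : ℕ} {α δ : ℝ} {w : ℕ → ℕ → Ω → ℕ}
  {Q : Measure Ω}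

theorem history_le (hw : ∀ r l, Measurable (w r l)) (n k : ℕ) : history m w n k ≤ mΩ := by
  refine iSup₂_le fun p _ => ?_
  rw [← measurable_iff_comap_le]
  let _ : MeasurableSpace (Finset ℕ) := ⊤
  exact (measurable_of_countable fun i : ℕ =>
    if p.1 = 1 then ({1} : Finset ℕ) else {p.1, i}).comp (hw p.1 p.2)

theorem normalizer_pos (hm : 1 ≤ m) (hδ : -1 < δ) (w : ℕ → ℕ → ℕ) {n : ℕ} (hn : 1 ≤ n) (k : ℕ) :
    0 < normalizer m α δ w n k := by
  refine Finset.sum_pos (fun j hj => ?_) ⟨1, by simp [hn]⟩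
  rw [Finset.mem_Icc] at hj
  have := birthRate_pos (α := α) hδ (hm.trans (le_degree m w k hj.1 hj.2))
  rwa [birthRate, add_comm] at this

/-- Half-edges are attached to older vertices. -/
theorem IsInverseDePrefGraph.ae_mem_Icc [IsProbabilityMeasure Q]
    (hw : IsInverseDePrefGraph m α δ w Q) (hm : 1 ≤ m) (hδ : -1 < δ) {n k : ℕ} (hn : 1 ≤ n)
    (hk : k < m) : ∀ᵐ ω ∂Q, w (n + 1) (k + 1) ω ∈ Finset.Icc 1 n := by
  have hle := history_le (m := m) hw.measurable n k
  have hS : ∀ i, MeasurableSet {ω | w (n + 1) (k + 1) ω = i} := fun i =>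
    hw.measurable _ _ (measurableSet_singleton i)
  -- The rule prescribes probabilities only for `1 ≤ i ≤ n`. They add up to one, which leaves no
  -- mass for other values.
  have hint : ∑ i ∈ Finset.Icc 1 n, Q.real {ω | w (n + 1) (k + 1) ω = i} = 1 := by
    have h1 : ∀ i, Q.real {ω | w (n + 1) (k + 1) ω = i}
        = ∫ ω, (Q⟦{ω | w (n + 1) (k + 1) ω = i} | history m w n k⟧) ω ∂Q := by
      intro i
      rw [integral_condExp hle, integral_indicator_const _ (hS i)]
      simp
    simp_rw [h1]
    rw [← integral_finsetSum _ fun i _ => integrable_condExp]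
    have h2 : (fun ω => ∑ i ∈ Finset.Icc 1 n,
        (Q⟦{ω | w (n + 1) (k + 1) ω = i} | history m w n k⟧) ω) =ᵐ[Q] fun _ => 1 := by
      have h3 : ∀ᵐ ω ∂Q, ∀ i ∈ Finset.Icc 1 n,
          (Q⟦{ω | w (n + 1) (k + 1) ω = i} | history m w n k⟧) ω
            = (normalizer m α δ (fun r l => w r l ω) n k)⁻¹ *
              (1 / (δ + (degree m (fun r l => w r l ω) i n k : ℝ)) ^ α) := by
        rw [Filter.eventually_all_finset]
        intro i hi
        rw [Finset.mem_Icc] at hi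
        exact hw.attach n k i hn hk hi.1 hi.2
      filter_upwards [h3] with ω hω
      rw [Finset.sum_congr rfl hω, ← Finset.mul_sum]
      exact inv_mul_cancel₀ (normalizer_pos hm hδ _ hn k).ne'
    rw [integral_congr_ae h2]
    simp
  have hU : Q.real (⋃ i ∈ Finset.Icc 1 n, {ω | w (n + 1) (k + 1) ω = i}) = 1 := by
    rw [← hint, measureReal_biUnion_finset (fun i _ i' _ hne => ?_) fun i _ => hS i]
    exact Set.disjoint_left.2 fun ω h h' => hne (h.symm.trans h')
  have hm' : MeasurableSet (⋃ i ∈ Finset.Icc 1 n, {ω | w (n + 1) (k + 1) ω = i}) :=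
    Finset.measurableSet_biUnion _ fun i _ => hS i
  have hU' : Q (⋃ i ∈ Finset.Icc 1 n, {ω | w (n + 1) (k + 1) ω = i}) = 1 := by
    rw [measureReal_def] at hU
    rwa [ENNReal.toReal_eq_one_iff] at hU
  have := (mem_ae_iff_prob_eq_one hm').2 hU'
  filter_upwards [this] with ω hω
  simpa using hω

/-- The vertex, shifted down by one, to which the `s`-th half-edge is attached. -/
def attachSeq (m : ℕ) (w : ℕ → ℕ → Ω → ℕ) (ω : Ω) (s : ℕ) : ℕ :=
  w (halfEdge m s).1 (halfEdge m s).2 ω - 1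

theorem measurable_attachSeq (hw : ∀ r l, Measurable (w r l)) : Measurable (attachSeq m w) :=
  measurable_pi_lambda _ fun _ => (measurable_of_countable fun i : ℕ => i - 1).comp (hw _ _)

theorem IsInverseDePrefGraph.ae_attachSeq [IsProbabilityMeasure Q]
    (hw : IsInverseDePrefGraph m α δ w Q) (hm : 1 ≤ m) (hδ : -1 < δ) :
    ∀ᵐ ω ∂Q, ∀ s, attachSeq m w ω s ∈ present m s ∧
      w (halfEdge m s).1 (halfEdge m s).2 ω = attachSeq m w ω s + 1 := by
  rw [ae_all_iff]
  intro s
  filter_upwards [hw.ae_mem_Icc hm hδ (n := s / m + 1) (k := s % m) (Nat.le_add_left 1 _)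
    (Nat.mod_lt s (by omega))] with ω hω
  simp only [Finset.mem_Icc] at hω
  simp only [attachSeq, halfEdge, present, Finset.mem_range]
  change _ ≤ w (s / m + 2) _ ω ∧ w (s / m + 2) _ ω ≤ _ at hω
  omega

/-- The conditional law of the next attachment given the earlier ones. -/
theorem IsInverseDePrefGraph.measure_attach_succ [IsProbabilityMeasure Q]
    (hw : IsInverseDePrefGraph m α δ w Q) (hm : 1 ≤ m) (a : ℕ → ℕ)
    (N : ℕ) (ha : ∀ s ≤ N, a s ∈ present m s) :
    Q {ω | ∀ s < N + 1, w (halfEdge m s).1 (halfEdge m s).2 ω = a s + 1}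
      = Q {ω | ∀ s < N, w (halfEdge m s).1 (halfEdge m s).2 ω = a s + 1} *
        ringProb (present m) (clockRates m α δ) a N := by
  set n := N / m with hn
  set k := N % m with hk
  have hkm : k < m := Nat.mod_lt N (by omega)
  have hN : N = n * m + k := (Nat.div_add_mod' N m).symm
  have hle := history_le (m := m) hw.measurable (n + 1) k
  set G := {ω | ∀ s < N, w (halfEdge m s).1 (halfEdge m s).2 ω = a s + 1} with hG
  set S := {ω | w (n + 1 + 1) (k + 1) ω = a N + 1} with hS
  have hSm : MeasurableSet S := hw.measurable _ _ (measurableSet_singleton _)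
  have hlt : ∀ s ≤ N, a s + 1 < (halfEdge m s).1 := fun s hs => by
    have := ha s hs
    simp only [present, Finset.mem_range] at this
    simp only [halfEdge]
    omega
  have hGm : MeasurableSet[history m w (n + 1) k] G := by
    simp only [hG, Set.ofPred_forall]
    refine MeasurableSet.iInter fun s => MeasurableSet.iInter fun hs => ?_
    have h1 := hlt s hs.le
    refine measurableSet_history ((lt_iff_halfEdge_mem_placed hkm).1 (hN ▸ hs)) ?_ (by omega)
    simp [halfEdge]
  have hset : {ω | ∀ s < N + 1, w (halfEdge m s).1 (halfEdge m s).2 ω = a s + 1} = S ∩ G := by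
    ext ω
    simp only [hG, hS, Set.mem_ofPred_eq, Set.mem_inter_iff]
    have e : halfEdge m N = (n + 1 + 1, k + 1) := rfl
    constructor
    · intro h
      exact ⟨by simpa [e] using h N (Nat.lt_succ_self N), fun s hs => h s (by omega)⟩
    · rintro ⟨h1, h2⟩ s hs
      rcases Nat.lt_succ_iff_lt_or_eq.1 hs with hs | rfl
      · exact h2 s hs
      · simpa [e] using h1
  have haN : a N < n + 1 := by simpa [present] using ha N le_rfl
  -- On `G` the past is fixed, so the degrees, and with them the attachment weights, are constants;
  -- they equal the current rates of the heads.
  have hdeg : ∀ ω ∈ G, ∀ j, 1 ≤ j → j ≤ n + 1 →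
      1 / (δ + (degree m (fun r l => w r l ω) j (n + 1) k : ℝ)) ^ α
        = shiftedRates (clockRates m α δ) a N (j - 1, 0) := by
    intro ω hω j hj hjn
    rw [degree_eq_count hkm (fun s hs => ?_) hj hjn]
    · rw [shiftedRates, clockRates, birthRate, add_comm, ← hN]
      have : Nat.count (fun s => w (halfEdge m s).1 (halfEdge m s).2 ω = j) N
          = Nat.count (fun r => a r = j - 1) N := by
        simp only [Nat.count_eq_card_filter_range]
        congr 1
        refine Finset.filter_congr fun s hs => ?_
        rw [hω s (Finset.mem_range.1 hs)]
        omega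
      simp [this]
    · have hs' : s < N := hN ▸ hs
      have := hω s hs'
      simp only [this]
      exact hlt s hs'.le
  set p : ℝ := shiftedRates (clockRates m α δ) a N (a N, 0) /
    ∑ j ∈ present m N, shiftedRates (clockRates m α δ) a N (j, 0) with hp
  have hval : ∀ ω ∈ G, (normalizer m α δ (fun r l => w r l ω) (n + 1) k)⁻¹ *
      (1 / (δ + (degree m (fun r l => w r l ω) (a N + 1) (n + 1) k : ℝ)) ^ α) = p := by
    intro ω hω
    rw [hdeg ω hω _ (by omega) (by omega), normalizer, hp, Nat.add_sub_cancel, div_eq_inv_mul]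
    congr 2
    rw [present, ← hn, Finset.sum_congr rfl fun j hj => hdeg ω hω j (Finset.mem_Icc.1 hj).1
      (Finset.mem_Icc.1 hj).2]
    refine Finset.sum_nbij' (fun j => j - 1) (fun j => j + 1)
      (fun j hj => Finset.mem_range.2 ?_) (fun j hj => Finset.mem_Icc.2 ?_)
      (fun j hj => ?_) (fun j hj => ?_) (fun j hj => rfl)
    · have := Finset.mem_Icc.1 hj; omega
    · have := Finset.mem_range.1 hj; omega
    · have := Finset.mem_Icc.1 hj; omega
    · omega
  -- The conditional probability of `S` is integrated over `G`, an event of the history on which it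
  -- is almost surely the constant `p`.
  have hreal : Q.real (S ∩ G) = Q.real G * p := by
    have h1 : ∫ ω in G, (Q⟦S | history m w (n + 1) k⟧) ω ∂Q = Q.real (S ∩ G) := by
      rw [setIntegral_condExp hle ((integrable_const (1 : ℝ)).indicator hSm) hGm,
        integral_indicator_const _ hSm]
      simp [measureReal_restrict_apply hSm]
    rw [← h1, setIntegral_congr_ae (g := fun _ => p) (hle _ hGm)]
    · simp
    · filter_upwards [hw.attach (n + 1) k (a N + 1) (by omega) hkm (by omega) (by omega)]
        with ω hω hωG
      rw [hS, hω, hval ω hωG]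
  rw [hset, ringProb, if_pos (ha N le_rfl), ← hp, ← ofReal_measureReal, hreal,
    ENNReal.ofReal_mul measureReal_nonneg, ofReal_measureReal]

/-- The law of the sequence of attachments. -/
theorem IsInverseDePrefGraph.measure_attachSeq [IsProbabilityMeasure Q]
    (hw : IsInverseDePrefGraph m α δ w Q) (hm : 1 ≤ m) (hδ : -1 < δ) (a : ℕ → ℕ) (N : ℕ) :
    Q {ω | ∀ s < N, attachSeq m w ω s = a s}
      = ∏ s ∈ Finset.range N, ringProb (present m) (clockRates m α δ) a s := by
  have hae := hw.ae_attachSeq hm hδ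
  by_cases ha : ∀ s < N, a s ∈ present m s
  · have h1 : Q {ω | ∀ s < N, attachSeq m w ω s = a s}
        = Q {ω | ∀ s < N, w (halfEdge m s).1 (halfEdge m s).2 ω = a s + 1} := by
      refine measure_congr ?_
      filter_upwards [hae] with ω hω
      refine propext (forall₂_congr fun s _ => ?_)
      rw [(hω s).2]
      omega
    rw [h1]
    clear h1
    induction N with
    | zero => simp
    | succ N ih =>
      rw [hw.measure_attach_succ hm a N fun s hs => ha s (Nat.lt_succ_of_le hs),
        ih fun s hs => ha s (hs.trans (Nat.lt_succ_self N)), Finset.prod_range_succ]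
  · push Not at ha
    obtain ⟨s, hs, has⟩ := ha
    -- A prefix naming a vertex not yet present has probability zero on both sides.
    rw [Finset.prod_eq_zero (Finset.mem_range.2 hs) (by rw [ringProb, if_neg has])]
    have : ∀ᵐ ω ∂Q, ¬ ∀ s < N, attachSeq m w ω s = a s := by
      filter_upwards [hae] with ω hω h
      exact has (h s hs ▸ (hω s).1)
    simpa [ae_iff] using this

theorem IsInverseDePrefGraph.ae_degree_eq [IsProbabilityMeasure Q]
    (hw : IsInverseDePrefGraph m α δ w Q) (hm : 1 ≤ m) (hδ : -1 < δ) :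
    ∀ᵐ ω ∂Q, ∀ j n k, 1 ≤ j → j ≤ n → k < m →
      degree m (fun r l => w r l ω) j n k = countDegree m (attachSeq m w ω) j n k := by
  filter_upwards [hw.ae_attachSeq hm hδ] with ω hω j n k hj hjn hk
  obtain ⟨n, rfl⟩ : ∃ n', n = n' + 1 := ⟨n - 1, by omega⟩
  rw [degree_eq_count hk (fun s _ => ?_) hj hjn, countDegree]
  · simp only [(hω _).2, Nat.add_sub_cancel]
  · have h1 := (hω s).1
    simp only [(hω s).2]
    simp only [present, Finset.mem_range] at h1
    simp only [halfEdge]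
    omega

end Graph

/-! ### Paths of birth processes -/

/-- A nondecreasing right-continuous path from `m` through all the states above `m`. -/
structure IsBirthPath (m : ℕ) (z : ℝ≥0 → ℕ) : Prop where
  init : z 0 = m
  mono : Monotone z
  rightCont : ∀ t, ContinuousWithinAt z (Set.Ici t) t
  visits : ∀ a, m ≤ a → ∃ t, z t = a

/-- Right-continuity makes the infimum defining `birthTime z a` attained: values of a discrete path
at times decreasing to it are eventually its value there. -/
theorem IsBirthPath.le_iff {m : ℕ} {z : ℝ≥0 → ℕ} (hz : IsBirthPath m z) {a : ℕ} (ha : m ≤ a)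
    (t : ℝ≥0) : a ≤ z t ↔ birthTime z a ≤ t := by
  refine ⟨fun h => csInf_le' h, fun h => ?_⟩
  obtain ⟨t₁, ht₁⟩ := hz.visits a ha
  have hne : {t | a ≤ z t}.Nonempty := ⟨t₁, ht₁.ge⟩
  have hcl := csInf_mem_closure hne (OrderBot.bddBelow _)
  have hbot : (nhdsWithin (birthTime z a) {t | a ≤ z t}).NeBot :=
    mem_closure_iff_nhdsWithin_neBot.1 hcl
  have hsub : {t | a ≤ z t} ⊆ Set.Ici (birthTime z a) := fun s hs => csInf_le' hs
  have hev := (hz.rightCont (birthTime z a)).eventually (isOpen_discrete {z (birthTime z a)}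
    |>.mem_nhds rfl)
  have hev' : ∀ᶠ s in nhdsWithin (birthTime z a) {t | a ≤ z t},
      z s ∈ ({z (birthTime z a)} : Set ℕ) := hev.filter_mono (nhdsWithin_mono _ hsub)
  obtain ⟨s, hs1, hs2⟩ := (hev'.and self_mem_nhdsWithin).exists
  have h3 : a ≤ z (birthTime z a) := by rw [← Set.mem_singleton_iff.1 hs1]; exact hs2
  exact h3.trans (hz.mono h)

theorem IsBirthPath.birthTime_init {m : ℕ} {z : ℝ≥0 → ℕ} (hz : IsBirthPath m z) :
    birthTime z m = 0 :=
  nonpos_iff_eq_zero.1 ((hz.le_iff le_rfl 0).1 hz.init.ge)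

/-- The holding times of the processes `z 1, z 2, …`, the process `z (j + 1)` in row `j`. -/
noncomputable def holdingTimes (m : ℕ) (z : ℕ → ℝ≥0 → ℕ) (q : ℕ × ℕ) : ℝ :=
  (birthTime (z (q.1 + 1)) (m + q.2 + 1) : ℝ) - birthTime (z (q.1 + 1)) (m + q.2)

/-- The time of the `s`-th ring. -/
noncomputable def ringTime (A : ℕ → Finset ℕ) (x : ℕ × ℕ → ℝ) (s : ℕ) : ℝ :=
  ∑ r ∈ Finset.range s, remaining A x r (ringRow A x r, 0)

/-- The number of rings in row `j` among the first `s`. -/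
noncomputable def ringCount (A : ℕ → Finset ℕ) (x : ℕ × ℕ → ℝ) (j s : ℕ) : ℕ :=
  Nat.count (fun r => ringRow A x r = j) s

theorem mem_present_iff {m : ℕ} (hm : 1 ≤ m) (j s : ℕ) : j ∈ present m s ↔ j * m ≤ s := by
  rw [present, Finset.mem_range, Nat.lt_succ_iff, Nat.le_div_iff_mul_le (by omega)]

/-! ### Births in the running processes as rings of the clocks. -/

section Embedding

variable {m : ℕ} {z : ℕ → ℝ≥0 → ℕ}

local notation "xx" => holdingTimes m z
local notation "yy" => remaining (present m) (holdingTimes m z)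
local notation "tt" => ringTime (present m) (holdingTimes m z)
local notation "cc" => ringRow (present m) (holdingTimes m z)
local notation "dd" => ringCount (present m) (holdingTimes m z)

variable (m z) in
/-- The remaining times after `s` rings, in terms of the birth times. -/
structure RemainingSpec (s : ℕ) : Prop where
  pos : ∀ q, 0 < yy s q
  tail : ∀ j i, yy s (j, i + 1) = xx (j, dd j s + i + 1)
  absent : ∀ j, s < j * m → dd j s = 0 ∧ yy s (j, 0) = xx (j, 0)
  head : ∀ j, j * m ≤ s →
    yy s (j, 0) = tt (j * m) + birthTime (z (j + 1)) (m + dd j s + 1) - tt s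
  birth_le : ∀ j, j * m ≤ s → (birthTime (z (j + 1)) (m + dd j s) : ℝ) ≤ tt s - tt (j * m)

/-- Row `j` starts at ring number `j * m`. At each ring the running heads other than the winner lose
exactly the amount by which `ringTime` grows, and stay positive because the winner is strictly
first. The winning row passes to its next holding time. -/
theorem remainingSpec (hm : 1 ≤ m) (hz : ∀ j, 1 ≤ j → IsBirthPath m (z j))
    (hpos : ∀ q, 0 < xx q) (hfirst : ∀ s, ∃ c, IsFirst (present m s) (yy s) c) (s : ℕ) :
    RemainingSpec m z s := by
  have hzero : ∀ j, (birthTime (z (j + 1)) m : ℝ) = 0 := fun j => by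
    rw [(hz (j + 1) (by omega)).birthTime_init]; rfl
  induction s with
  | zero =>
    refine ⟨hpos, fun j i => ?_, fun j _ => ⟨by simp [ringCount], rfl⟩, fun j hj => ?_,
      fun j hj => ?_⟩
    · simp [ringCount, remaining]
    · have : j * m = 0 := by omega
      rw [this]
      simp [ringCount, remaining, holdingTimes, hzero]
    · have : j * m = 0 := by omega
      rw [this]
      simp [ringCount, hzero]
  | succ s ih =>
    obtain ⟨c, hc⟩ := hfirst s
    have hcc : cc s = c := hc.firstRow_eq
    have hcm : c * m ≤ s := (mem_present_iff hm c s).1 hc.1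
    have hy : yy (s + 1) = advance (present m s) c (yy s) := by
      rw [remaining, hc.firstRow_eq]
    have ht : tt (s + 1) = tt s + yy s (c, 0) := by
      rw [ringTime, Finset.sum_range_succ, hcc]; rfl
    have hdc : dd c (s + 1) = dd c s + 1 := by
      rw [ringCount, Nat.count_succ, if_pos hcc]; rfl
    have hdj : ∀ j, j ≠ c → dd j (s + 1) = dd j s := fun j hj => by
      rw [ringCount, Nat.count_succ, if_neg (by rw [hcc]; exact hj.symm)]; rfl
    have hyc : ∀ i, yy (s + 1) (c, i) = yy s (c, i + 1) := fun i => by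
      rw [hy]; simp [advance, nextClock]
    have hyj : ∀ j i, j ≠ c → yy (s + 1) (j, i + 1) = yy s (j, i + 1) := fun j i hj => by
      rw [hy]; simp [advance, nextClock, hj]
    have hy0 : ∀ j, j ≠ c → j * m ≤ s → yy (s + 1) (j, 0) = yy s (j, 0) - yy s (c, 0) :=
      fun j hj hjs => by
        rw [hy]; simp [advance, hj, (mem_present_iff hm j s).2 hjs]
    have hya : ∀ j, s < j * m → yy (s + 1) (j, 0) = yy s (j, 0) := fun j hjs => by
      have h1 : j ≠ c := by rintro rfl; omega
      have h2 : j ∉ present m s := fun h => by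
        have := (mem_present_iff hm j s).1 h; omega
      rw [hy]; simp [advance, nextClock, h1, h2]
    have htc : tt (s + 1) = tt (c * m) + birthTime (z (c + 1)) (m + dd c s + 1) := by
      rw [ht, ih.head c hcm]; ring
    refine ⟨?_, ?_, ?_, ?_, ?_⟩
    · rintro ⟨j, i⟩
      by_cases hj : j = c
      · subst hj; rw [hyc]; exact ih.pos _
      · rcases i with _ | i
        · rcases le_or_gt (j * m) s with hjs | hjs
          · rw [hy0 j hj hjs]
            exact sub_pos.2 (hc.2 j ((mem_present_iff hm j s).2 hjs) hj)
          · rw [hya j hjs]; exact ih.pos _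
        · rw [hyj j i hj]; exact ih.pos _
    · intro j i
      by_cases hj : j = c
      · subst hj
        rw [hyc, ih.tail, hdc]
        congr 2
        ring
      · rw [hyj j i hj, ih.tail, hdj j hj]
    · intro j hjs
      have hj : j ≠ c := by rintro rfl; omega
      rw [hdj j hj, hya j (by omega)]
      exact ih.absent j (by omega)
    · intro j hjs
      by_cases hj : j = c
      · subst hj
        rw [hyc, ih.tail, hdc, htc, holdingTimes]
        simp only [add_zero, ← add_assoc]
        ring
      · rw [hdj j hj]
        rcases le_or_gt (j * m) s with hjs' | hjs'
        · rw [hy0 j hj hjs', ih.head j hjs', ht]; ring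
        -- Process `j + 1` starts exactly at this ring, with its first holding time still whole.
        · have hjm : j * m = s + 1 := by omega
          rw [hya j hjs', (ih.absent j hjs').1, (ih.absent j hjs').2, hjm, holdingTimes]
          simp [hzero]
    · intro j hjs
      by_cases hj : j = c
      · subst hj
        rw [hdc, htc]
        simp [← add_assoc]
      · rw [hdj j hj]
        rcases le_or_gt (j * m) s with hjs' | hjs'
        · have := ih.birth_le j hjs'
          have := ih.pos (c, 0)
          rw [ht]; linarith
        · have hjm : j * m = s + 1 := by omega
          rw [(ih.absent j hjs').1, hjm]
          simp [hzero]

/-- The state of a running process at the time of a ring. -/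
theorem RemainingSpec.apply_eq {s j : ℕ} (hs : RemainingSpec m z s)
    (hz : IsBirthPath m (z (j + 1))) (hj : j * m ≤ s) {σ τ : ℝ≥0} (hσ : (σ : ℝ) = tt s)
    (hτ : (τ : ℝ) = tt (j * m)) : z (j + 1) (σ - τ) = m + dd j s := by
  have h1 := hs.birth_le j hj
  have h2 := hs.pos (j, 0)
  rw [hs.head j hj] at h2
  have hle : τ ≤ σ := by
    rw [← NNReal.coe_le_coe, hσ, hτ]
    have : (0 : ℝ) ≤ birthTime (z (j + 1)) (m + dd j s) := NNReal.coe_nonneg _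
    linarith
  refine le_antisymm ?_ ?_
  · by_contra hcon
    have h3 := (hz.le_iff (a := m + dd j s + 1) (by omega) (σ - τ)).1 (by omega)
    rw [← NNReal.coe_le_coe, NNReal.coe_sub hle, hσ, hτ] at h3
    linarith
  · rw [hz.le_iff (by omega), ← NNReal.coe_le_coe, NNReal.coe_sub hle, hσ, hτ]
    exact h1

/-- The waiting time for the next birth is the remaining time of the first clock to ring. -/
theorem RemainingSpec.gap_eq {s n : ℕ} (hm : 1 ≤ m) (hs : RemainingSpec m z s)
    (hz : ∀ j, 1 ≤ j → IsBirthPath m (z j))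
    (hfirst : ∃ c, IsFirst (present m s) (yy s) c) (hn : s / m = n) {σ : ℝ≥0} {τ : ℕ → ℝ≥0}
    (hσ : (σ : ℝ) = tt s) (hτ : ∀ j ≤ n, (τ (j + 1) : ℝ) = tt (j * m)) :
    (gap z τ (n + 1) σ : ℝ) = yy s (cc s, 0) := by
  obtain ⟨c, hc⟩ := hfirst
  have hcc : cc s = c := hc.firstRow_eq
  have hcn : c ≤ n := by
    have := hc.1
    rw [present, hn, Finset.mem_range] at this
    omega
  have hpr : ∀ j ≤ n, j * m ≤ s := fun j hj =>
    (mem_present_iff hm j s).1 (by rw [present, hn, Finset.mem_range]; omega)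
  have hlt : ∀ j ≤ n, ∀ g : ℝ≥0,
      z (j + 1) (σ - τ (j + 1)) < z (j + 1) (σ + g - τ (j + 1)) ↔ yy s (j, 0) ≤ g := by
    intro j hj g
    have hle : τ (j + 1) ≤ σ + g := by
      rw [← NNReal.coe_le_coe, NNReal.coe_add, hσ, hτ j hj]
      have := hs.birth_le j (hpr j hj)
      have h0 : (0 : ℝ) ≤ birthTime (z (j + 1)) (m + dd j s) := NNReal.coe_nonneg _
      have := g.coe_nonneg
      linarith
    rw [hs.apply_eq (hz _ (by omega)) (hpr j hj) hσ (hτ j hj), ← Nat.succ_le_iff,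
      Nat.succ_eq_add_one, (hz (j + 1) (by omega)).le_iff (by omega), ← NNReal.coe_le_coe,
      NNReal.coe_sub hle, NNReal.coe_add, hσ, hτ j hj, hs.head j (hpr j hj)]
    constructor <;> intro h <;> linarith
  -- The set in `gap` is a closed ray: some running process has jumped by `σ + g` exactly when the
  -- smallest head is at most `g`. Positivity of `g` is then automatic.
  have hset : {g : ℝ≥0 | 0 < g ∧ ∃ j, 1 ≤ j ∧ j ≤ n + 1 ∧
      z j (σ - τ j) < z j (σ + g - τ j)} = Set.Ici (yy s (c, 0)).toNNReal := by
    ext g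
    simp only [Set.mem_ofPred_eq, Set.mem_Ici, Real.toNNReal_le_iff_le_coe]
    constructor
    · rintro ⟨_, j, hj1, hjn, h⟩
      obtain ⟨j, rfl⟩ : ∃ j', j = j' + 1 := ⟨j - 1, by omega⟩
      have h2 := (hlt j (by omega) g).1 h
      by_cases hjc : j = c
      · rwa [← hjc]
      · exact (hc.2 j ((mem_present_iff hm j s).2 (hpr j (by omega))) hjc).le.trans h2
    · intro h
      refine ⟨NNReal.coe_pos.1 ((hs.pos _).trans_le h), c + 1, by omega, by omega,
        (hlt c hcn g).2 h⟩
  rw [gap, hset, csInf_Ici, hcc, Real.coe_toNNReal _ (hs.pos _).le]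

/-- The births in the running processes take place at the times of the rings. -/
theorem clock_eq_ringTime (hm : 1 ≤ m) (hz : ∀ j, 1 ≤ j → IsBirthPath m (z j))
    (hpos : ∀ q, 0 < xx q) (hfirst : ∀ s, ∃ c, IsFirst (present m s) (yy s) c) (n : ℕ)
    {k : ℕ} (hk : k ≤ m) : (clock z (tau m z) (n + 1) k : ℝ) = tt (n * m + k) := by
  induction n using Nat.strong_induction_on generalizing k with
  | _ n ihn =>
    -- The starting time of process `j + 2` is the clock of stage `j` after its last birth, `k = m`;
    -- hence the strong induction and the bound `k ≤ m` rather than `k < m`.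
    have htau : ∀ j ≤ n, (tau m z (j + 1) : ℝ) = tt (j * m) := by
      intro j hj
      rcases j with _ | j
      · simp [tau_one, ringTime]
      · rw [tau_succ m z (j + 1) (by omega), ← clock_tau, ihn j (by omega) le_rfl, Nat.succ_mul]
    induction k with
    | zero => exact htau n le_rfl
    | succ k ihk =>
      have hs := remainingSpec hm hz hpos hfirst (n * m + k)
      rw [clock, NNReal.coe_add, ihk (by omega),
        hs.gap_eq hm hz (hfirst _) (div_of_lt (by omega) n) (ihk (by omega)) htau,
        ← add_assoc (n * m) k 1, ringTime, ringTime, Finset.sum_range_succ]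

theorem embDegree_eq_countDegree (hm : 1 ≤ m) (hz : ∀ j, 1 ≤ j → IsBirthPath m (z j))
    (hpos : ∀ q, 0 < xx q) (hfirst : ∀ s, ∃ c, IsFirst (present m s) (yy s) c) {j n k : ℕ}
    (hj : 1 ≤ j) (hjn : j ≤ n) (hk : k < m) : embDegree m z j n k = countDegree m cc j n k := by
  obtain ⟨j, rfl⟩ : ∃ j', j = j' + 1 := ⟨j - 1, by omega⟩
  obtain ⟨n, rfl⟩ : ∃ n', n = n' + 1 := ⟨n - 1, by omega⟩
  have hs := remainingSpec hm hz hpos hfirst (n * m + k)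
  have hτ : (tau m z (j + 1) : ℝ) = tt (j * m) :=
    clock_eq_ringTime hm hz hpos hfirst j (Nat.zero_le m)
  have hjm : j * m ≤ n * m := Nat.mul_le_mul_right m (by omega)
  rw [embDegree, ← clock_tau, hs.apply_eq (hz _ (by omega)) (by omega)
    (clock_eq_ringTime hm hz hpos hfirst n hk.le) hτ, countDegree, ringCount]
  simp

end Embedding

/-! ### The law of the holding times -/

/-- The first time at level `a` or above, computed along the rational times. -/
noncomputable def ratBirthTime (a : ℕ) (z : ℝ≥0 → ℕ) : ℝ :=
  (⨅ q : ℚ, if a ≤ z (Real.toNNReal q) then (Real.toNNReal q : ℝ≥0∞) else ∞).toReal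

/-- `birthTime` is an infimum over uncountably many times. The rational version is measurable for
the product σ-algebra on paths, so independence of the processes passes to their holding times. -/
theorem measurable_ratBirthTime (a : ℕ) : Measurable (ratBirthTime a) := by
  refine (Measurable.iInf fun q => Measurable.ite ?_ measurable_const
    measurable_const).ennreal_toReal
  exact measurableSet_le measurable_const (measurable_pi_apply _)

/-- By `IsBirthPath.le_iff` every rational time after `birthTime z a` is at level `a` or above, and
such times come arbitrarily close. -/
theorem IsBirthPath.ratBirthTime_eq {m : ℕ} {z : ℝ≥0 → ℕ} (hz : IsBirthPath m z) {a : ℕ}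
    (ha : m ≤ a) : ratBirthTime a z = birthTime z a := by
  have : (⨅ q : ℚ, if a ≤ z (Real.toNNReal q) then (Real.toNNReal q : ℝ≥0∞) else ∞)
      = birthTime z a := by
    refine le_antisymm (le_of_forall_gt fun c hc => ?_) (le_iInf fun q => ?_)
    · obtain ⟨q, _, h1, h2⟩ := ENNReal.lt_iff_exists_rat_btwn.1 hc
      refine iInf_lt_iff.2 ⟨q, ?_⟩
      rwa [if_pos ((hz.le_iff ha _).2 (by exact_mod_cast h1.le))]
    · split_ifs with h
      · exact_mod_cast (hz.le_iff ha _).1 h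
      · exact le_top
  rw [ratBirthTime, this, ENNReal.coe_toReal]

section Law

variable {Ω : Type*} [MeasurableSpace Ω] {P : Measure Ω} {m : ℕ}

theorem IsPureBirthProcess.ae_isBirthPath {rate : ℕ → ℝ} {Z : ℝ≥0 → Ω → ℕ}
    (hZ : IsPureBirthProcess m rate Z P) : ∀ᵐ ω ∂P, IsBirthPath m fun t => Z t ω := by
  filter_upwards [hZ.init, hZ.mono, hZ.rightCont, hZ.visits] with ω h1 h2 h3 h4
  exact ⟨h1, h2, h3, h4⟩

/-- The holding times of independent pure birth processes are independent exponential clocks. -/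
theorem hasLaw_holdingTimes [IsProbabilityMeasure P] {rate : ℕ → ℝ} {Z : ℕ → ℝ≥0 → Ω → ℕ}
    (hZ : ∀ j, 1 ≤ j → IsPureBirthProcess m rate (Z j) P)
    (hind : iIndepFun (fun (j : ℕ+) (ω : Ω) (t : ℝ≥0) => Z j t ω) P) :
    HasLaw (fun ω => holdingTimes m fun j t => Z j t ω)
      (expArray fun q => rate (m + q.2)) P := by
  set g : ℕ → (ℝ≥0 → ℕ) → ℝ := fun i z => ratBirthTime (m + i + 1) z - ratBirthTime (m + i) z
    with hg
  have hgm : ∀ i, Measurable (g i) := fun i =>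
    (measurable_ratBirthTime _).sub (measurable_ratBirthTime _)
  set X : ℕ → ℕ → Ω → ℝ := fun j i ω => g i fun t => Z (j + 1) t ω with hX
  have hXm : ∀ j i, Measurable (X j i) := fun j i =>
    (hgm i).comp (measurable_pi_lambda _ fun t => (hZ (j + 1) (by omega)).measurable t)
  have hae : ∀ j i, (fun ω => (birthTime (fun t => Z (j + 1) t ω) (m + i + 1) : ℝ)
      - birthTime (fun t => Z (j + 1) t ω) (m + i)) =ᵐ[P] X j i := by
    intro j i
    filter_upwards [(hZ (j + 1) (by omega)).ae_isBirthPath] with ω hω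
    simp only [hX, hg]
    rw [hω.ratBirthTime_eq (by omega), hω.ratBirthTime_eq (by omega)]
  -- Independence between rows comes from the processes, independence within a row from the holding
  -- times of one process; together they make the whole array independent.
  have hrows : iIndepFun (fun j ω => (X j · ω)) P := by
    have h : iIndepFun (fun (j : ℕ) (ω : Ω) (t : ℝ≥0) => Z (j + 1) t ω) P :=
      hind.precomp (g := Nat.succPNat) Nat.succPNat_injective
    exact h.comp (fun _ z i => g i z) (fun _ => measurable_pi_lambda _ hgm)
  have hwithin : ∀ j, iIndepFun (X j) P := fun j =>
    (hZ (j + 1) (by omega)).indep.congr (hae j)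
  have hall : iIndepFun (fun (q : ℕ × ℕ) ω => X q.1 q.2 ω) P :=
    iIndepFun_uncurry' hXm hrows hwithin
  clear_value X
  have hlaw : ∀ q : ℕ × ℕ, HasLaw (X q.1 q.2) (expMeasure (rate (m + q.2))) P := fun q =>
    ((hZ (q.1 + 1) (by omega)).law q.2).congr (hae q.1 q.2).symm
  have hm : Measurable fun ω (q : ℕ × ℕ) => X q.1 q.2 ω :=
    measurable_pi_lambda _ fun q => hXm q.1 q.2
  have hX' : HasLaw (fun ω (q : ℕ × ℕ) => X q.1 q.2 ω) (expArray fun q => rate (m + q.2)) P :=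
    hall.hasLaw_infinitePi hlaw hm.aemeasurable
  refine hX'.congr ?_
  filter_upwards [ae_all_iff.2 fun q : ℕ × ℕ => hae q.1 q.2] with ω hω
  exact funext hω

end Law

end DePref

/-! ### Conclusion: transfer from the two sequences to the degree arrays. -/

theorem theorem4p3 {Ω Ω' : Type*} [MeasurableSpace Ω] [MeasurableSpace Ω']
    (P : Measure Ω) [IsProbabilityMeasure P] (Q : Measure Ω') [IsProbabilityMeasure Q]
    (m : ℕ) (hm : 1 ≤ m) (α δ : ℝ) (hα : 0 < α) (hδ : -1 < δ)
    -- i.i.d. pure birth processes `Z 1, Z 2, …` started from `m` with rates `(i + δ)^{-α}`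
    (Z : ℕ → ℝ≥0 → Ω → ℕ)
    (hZ : ∀ j : ℕ, 1 ≤ j →
      DePref.IsPureBirthProcess m (fun i => 1 / ((i : ℝ) + δ) ^ α) (Z j) P)
    (hZindep : iIndepFun (fun (j : ℕ+) (ω : Ω) (t : ℝ≥0) => Z j t ω) P)
    -- the graph process
    (w : ℕ → ℕ → Ω' → ℕ) (hw : DePref.IsInverseDePrefGraph m α δ w Q) :
    IdentDistrib
      (fun (ω : Ω) (p : DePref.Index m) =>
        DePref.embDegree m (fun j t => Z j t ω) p.1.2.1 p.1.1 p.1.2.2)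
      (fun (ω : Ω') (p : DePref.Index m) =>
        DePref.degree m (fun r l => w r l ω) p.1.2.1 p.1.1 p.1.2.2)
      P Q := by
  open DePref in
  set X : Ω → ℕ × ℕ → ℝ := fun ω => holdingTimes m fun j t => Z j t ω with hX
  have hlaw : HasLaw X (expArray (clockRates m α δ)) P := hasLaw_holdingTimes hZ hZindep
  have hρ := clockRates_pos (α := α) hm hδ
  have := isProbabilityMeasure_expArray hρ
  set G : (ℕ → ℕ) → Index m → ℕ := fun c p => countDegree m c p.1.2.1 p.1.1 p.1.2.2 with hG
  have hGm : Measurable G := measurable_pi_lambda _ fun p => measurable_countDegree m _ _ _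
  have hR := measurable_ringRow (present m)
  have hRX : AEMeasurable (fun ω => ringRow (present m) (X ω)) P :=
    hR.comp_aemeasurable hlaw.aemeasurable
  have hseq : IdentDistrib (fun ω => ringRow (present m) (X ω)) (attachSeq m w) P Q := by
    refine ⟨hRX, (measurable_attachSeq hw.measurable).aemeasurable, ?_⟩
    have hmap : P.map (fun ω => ringRow (present m) (X ω))
        = (expArray (clockRates m α δ)).map (ringRow (present m)) := by
      rw [← hlaw.map_eq, AEMeasurable.map_map_of_aemeasurable hR.aemeasurable hlaw.aemeasurable]
      rfl
    have := Measure.isProbabilityMeasure_map (μ := P) hRX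
    refine ext_of_initial_segments fun a N => ?_
    have hcyl : MeasurableSet {c : ℕ → ℕ | ∀ s < N, c s = a s} := by
      simp only [Set.ofPred_forall]
      exact MeasurableSet.iInter fun s => MeasurableSet.iInter fun _ =>
        measurableSet_eq_fun (measurable_pi_apply s) measurable_const
    rw [hmap, Measure.map_apply hR hcyl,
      Measure.map_apply (measurable_attachSeq hw.measurable) hcyl]
    exact (expArray_ringRow hρ (present_nonempty m) a N).trans
      (hw.measure_attachSeq hm hδ a N).symm
  have hP : (fun ω (p : Index m) => embDegree m (fun j t => Z j t ω) p.1.2.1 p.1.1 p.1.2.2)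
      =ᵐ[P] fun ω => G (ringRow (present m) (X ω)) := by
    have hpath : ∀ᵐ ω ∂P, ∀ j, 1 ≤ j → IsBirthPath m fun t => Z j t ω :=
      ae_all_iff.2 fun j => ae_all_iff.2 fun hj => (hZ j hj).ae_isBirthPath
    have hpos : ∀ᵐ y ∂expArray (clockRates m α δ), ∀ q, 0 < y q := by
      have : ∀ q, IsProbabilityMeasure (expMeasure (clockRates m α δ q)) :=
        fun q => isProbabilityMeasure_expMeasure (hρ q)
      refine ae_all_iff.2 fun q => ?_
      exact (measurePreserving_eval_infinitePi
        (fun q => expMeasure (clockRates m α δ q)) q).quasiMeasurePreserving.ae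
        (ae_pos_expMeasure _)
    have hfirst := ae_forall_exists_isFirst hρ (present_nonempty m)
    -- Positivity and absence of ties, known for the clock array, are pulled back to the holding
    -- times on `Ω`.
    rw [← hlaw.map_eq] at hpos hfirst
    filter_upwards [hpath, ae_of_ae_map hlaw.aemeasurable hpos,
      ae_of_ae_map hlaw.aemeasurable hfirst] with ω h1 h2 h3
    funext p
    exact embDegree_eq_countDegree hm h1 h2 h3 p.2.2.1 p.2.2.2.1 p.2.2.2.2
  have hQ : (fun ω (p : Index m) => degree m (fun r l => w r l ω) p.1.2.1 p.1.1 p.1.2.2)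
      =ᵐ[Q] fun ω => G (attachSeq m w ω) := by
    filter_upwards [hw.ae_degree_eq hm hδ] with ω hω
    funext p
    exact hω _ _ _ p.2.2.1 p.2.2.2.1 p.2.2.2.2
  have hcomp := hseq.comp hGm
  exact ⟨hcomp.aemeasurable_fst.congr hP.symm, hcomp.aemeasurable_snd.congr hQ.symm,
    (Measure.map_congr hP).trans (hcomp.map_eq.trans (Measure.map_congr hQ.symm))⟩
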